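/- **Theorem (Accuracy of Approximation).** *Network.* Finitely many agents, each with an iterate in $\mathbb{R}^M$, form a weakly-connected network with combination matrix $A=[a_{\ell k}]$, where $a_{\ell k}\ge 0$ and $\sum_\ell a_{\ell k}=1$ for every $k$. The agents are partitioned into $S$ sending sub-networks (group $S$) and $R$ receiving sub-networks (group $R$), so that $$A=\begin{bmatrix} T_{SS} & T_{SR}\\ 0 & T_{RR}\end{bmatrix},$$ with $T_{SS}=\mathrm{blockdiag}\{A_1,\dots,A_S\}$ and $T_{RR}$ block upper triangular. Each sending sub-network is strongly connected (any two of its agents are linked in both directions by paths of positive weights, and some agent has $a_{kk}>0$). Each receiving sub-network is connected by paths of positive weights inside it, and at least one of its agents receives with positive weight from outside of it. *Costs.* Each cost $J_k:\mathbb{R}^M\to\mathbb{R}$ is convex and twice differentiable with bounded Hessian, and each sending sub-network has at least one strongly convex cost. The step-sizes are $\mu_k=\tau_k\mu_{\max}$ with fixed $0<\tau_k\le 1$. *Limit points.* Let $p_s$ be the Perron eigenvector of $A_s$ ($A_sp_s=p_s$, $\mathbf{1}^{\mathsf T}p_s=1$), with entries $p_k$ for the agents $k$ of sub-network $s$, and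 let $w_s^\star$ be the solution of $\sum_{k\in s}\mu_k p_k\nabla J_k(w_s^\star)=0$. Set $w_k^\star=w_s^\star$ for each agent $k$ of sending sub-network $s$, and let the limit points of the agents of group $R$ be the blocks of $(W\otimes I_M)^{\mathsf T}\,\mathrm{col}\{w_\ell^\star\}_{\ell\in S}$, where $W=T_{SR}(I-T_{RR})^{-1}$. Assume that for some $\kappa_d\ge0$, $\epsilon>0$ and every agent $k$, $$\|\nabla^2J_k(w_k^\star+\Delta w)-\nabla^2J_k(w_k^\star)\|\le\kappa_d\|\Delta w\|\quad\text{whenever }\|\Delta w\|\le\epsilon .$$ *Algorithm and noise.* The agents run $\boldsymbol\psi_{k,i}=\boldsymbol w_{k,i-1}-\mu_k\widehat{\nabla J}_k(\boldsymbol w_{k,i-1})$, $\boldsymbol w_{k,i}=\sum_\ell a_{\ell k}\boldsymbol\psi_{\ell,i}$, from initial iterates with finite fourth moments. With $\mathcal F_{i-1}$ the $\sigma$-algebra generated by all iterates up to time $i-1$, the gradient noise $\boldsymbol s_{k,i}=\widehat{\nabla J}_k(\boldsymbol w_{k,i-1})-\nabla J_k(\boldsymbol w_{k,i-1})$ satisfies,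 for constants $\beta_k,\sigma_k$ independent of $\mu_{\max}$, $$\mathbb E[\boldsymbol s_{k,i}\mid\mathcal F_{i-1}]=0,\qquad \mathbb E[\|\boldsymbol s_{k,i}\|^4\mid\mathcal F_{i-1}]\le\beta_k^4\|\boldsymbol w_{k,i-1}\|^4+\sigma_k^4 .$$ *The two models.* Let $\widetilde{\boldsymbol w}_{k,i}=w_k^\star-\boldsymbol w_{k,i}$ and $\widetilde{\boldsymbol{\mathcal W}}_i=\mathrm{col}\{\widetilde{\boldsymbol w}_{k,i}\}$. With $\mathcal A=A\otimes I_M$, $\mathcal M=\mathrm{diag}\{\mu_kI_M\}$, $\boldsymbol{\mathcal S}_i=\mathrm{col}\{\boldsymbol s_{k,i}\}$ and $b=-\mathrm{col}\{\nabla J_k(w_k^\star)\}$, the true error satisfies the nonlinear recursion $$\widetilde{\boldsymbol{\mathcal W}}_i=\mathcal A^{\mathsf T}\mathcal M\boldsymbol{\mathcal S}_i-\mathcal A^{\mathsf T}\mathcal M b+\mathcal A^{\mathsf T}(I-\mathcal M\boldsymbol{\mathcal H}_{i-1})\widetilde{\boldsymbol{\mathcal W}}_{i-1},\qquad \boldsymbol{\mathcal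 H}_{i}=\mathrm{diag}\Big\{\int_0^1\nabla^2J_k(w_k^\star-t\widetilde{\boldsymbol w}_{k,i})\,dt\Big\}.$$ Let $\widetilde{\boldsymbol{\mathcal W}}'_i$ be the long-term model: the same recursion with the same noise $\boldsymbol{\mathcal S}_i$, but with $\boldsymbol{\mathcal H}_{i-1}$ replaced by the constant $\mathcal H=\mathrm{diag}\{\nabla^2J_k(w_k^\star)\}$, started at any initial state with finite second moment. *Conclusion.* There are constants $C$ and $\mu_0>0$, depending only on the network, the costs, the limit points and $\tau_k,\kappa_d,\epsilon,\beta_k,\sigma_k$, such that for all $0<\mu_{\max}\le\mu_0$ the true error satisfies the above nonlinear recursion, $$\limsup_{i\to\infty}\mathbb E\|\widetilde{\boldsymbol{\mathcal W}}_i-\widetilde{\boldsymbol{\mathcal W}}'_i\|^2\le C\mu_{\max}^2,$$ the quantities $\limsup_i\mathbb E\|\widetilde{\boldsymbol{\mathcal W}}_i\|^2$ and $\limsup_i\mathbb E\|\widetilde{\boldsymbol{\mathcal W}}'_i\|^2$ are finite, and $$\Big|\limsup_{i\to\infty}\mathbb E\|\widetilde{\boldsymbol{\mathcal W}}_i\|^2-\limsup_{i\to\infty}\mathbb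 E\|\widetilde{\boldsymbol{\mathcal W}}'_i\|^2\Big|\le C\mu_{\max}^{3/2}.$$ -/

import Mathlib

open MeasureTheory

noncomputable section

namespace WeakNet

/-- The space `ℝ^M` with its Euclidean norm. -/
abbrev Vec (M : ℕ) : Type := EuclideanSpace ℝ (Fin M)

/-! ### The network -/

section Network

variable {V : Type*}

/-- The agents in `U` are connected: any two of them are linked, in both directions, by a path of
positive weights that stays inside `U`.  The entry `A ℓ k` is the weight that agent `k` gives to
the data received from agent `ℓ`. -/
def IsConnectedWithin (A : Matrix V V ℝ) (U : Set V) : Prop :=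
  ∀ ℓ ∈ U, ∀ k ∈ U, Relation.ReflTransGen (fun a b => a ∈ U ∧ b ∈ U ∧ 0 < A a b) ℓ k

/-- Strong connectivity: connected, and at least one agent has a self-loop of positive weight. -/
def IsStronglyConnectedWithin (A : Matrix V V ℝ) (U : Set V) : Prop :=
  IsConnectedWithin A U ∧ ∃ k ∈ U, 0 < A k k

variable {VS VR : Type*} {S R : ℕ}

/-- The agents of the sending sub-network `s`. -/
def sendAgents (subS : VS → Fin S) (s : Fin S) : Set (VS ⊕ VR) :=
  {v | ∃ k : VS, v = Sum.inl k ∧ subS k = s}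

/-- The agents of the receiving sub-network `r`. -/
def recvAgents (subR : VR → Fin R) (r : Fin R) : Set (VS ⊕ VR) :=
  {v | ∃ k : VR, v = Sum.inr k ∧ subR k = r}

/-- A weakly-connected network with combination matrix `A`.  The agents are those of group `S`
(type `VS`), split by `subS` into the sub-networks `0, …, S - 1`, and those of group `R`
(type `VR`), split by `subR` into the sub-networks `0, …, R - 1`. -/
structure IsWeaklyConnectedNetwork [Fintype VS] [Fintype VR]
    (A : Matrix (VS ⊕ VR) (VS ⊕ VR) ℝ) (subS : VS → Fin S) (subR : VR → Fin R) : Prop where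
  nonneg : ∀ ℓ k, 0 ≤ A ℓ k
  /-- `A` is left-stochastic. -/
  col_sum : ∀ k, ∑ ℓ, A ℓ k = 1
  /-- The block of the group `S` is block diagonal. -/
  send_diag : ∀ ℓ k : VS, subS ℓ ≠ subS k → A (Sum.inl ℓ) (Sum.inl k) = 0
  /-- Group `S` receives nothing from group `R`. -/
  no_feedback : ∀ (ℓ : VR) (k : VS), A (Sum.inr ℓ) (Sum.inl k) = 0
  /-- The block of the group `R` is block upper triangular. -/
  recv_triangular : ∀ ℓ k : VR, subR k < subR ℓ → A (Sum.inr ℓ) (Sum.inr k) = 0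
  send_strong : ∀ s, IsStronglyConnectedWithin A (sendAgents subS s)
  recv_connected : ∀ r, IsConnectedWithin A (recvAgents subR r)
  /-- The internal matrix of a receiving sub-network is not left-stochastic: some agent in it
  receives from outside of it. -/
  recv_receives : ∀ r, ∃ k ∈ recvAgents (VS := VS) subR r,
    ∃ ℓ, ℓ ∉ recvAgents (VS := VS) subR r ∧ 0 < A ℓ k

/-- The restriction of `p` to each sub-network `s` of group `S` is the Perron eigenvector of the
block `A_s`: `A_s p_s = p_s` and the entries of `p_s` add up to one.  (The blocks `A_s` make up
the block-diagonal upper left block of `A`.) -/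
def IsPerronFamily [Fintype VS] (A : Matrix (VS ⊕ VR) (VS ⊕ VR) ℝ) (subS : VS → Fin S)
    (p : VS → ℝ) : Prop :=
  A.toBlocks₁₁.mulVec p = p ∧ ∀ s, ∑ k with subS k = s, p k = 1

/-- `W = T_SR (I - T_RR)⁻¹`. -/
def influence [Fintype VR] [DecidableEq VR] (A : Matrix (VS ⊕ VR) (VS ⊕ VR) ℝ) :
    Matrix VS VR ℝ :=
  A.toBlocks₁₂ * (1 - A.toBlocks₂₂)⁻¹

/-- The limit point of every agent, from the Pareto solutions `wS s` of the sending sub-networks: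
`wS s` for an agent of sub-network `s`, and the block of `(W ⊗ I)ᵀ w^⋆` for a receiving agent. -/
def limitPoint [Fintype VS] [Fintype VR] [DecidableEq VR] {M : ℕ}
    (A : Matrix (VS ⊕ VR) (VS ⊕ VR) ℝ) (subS : VS → Fin S) (wS : Fin S → Vec M) :
    VS ⊕ VR → Vec M
  | Sum.inl k => wS (subS k)
  | Sum.inr k => ∑ ℓ : VS, influence A ℓ k • wS (subS ℓ)

end Network

/-! ### The costs -/

section Costs

variable {VS VR : Type*} {S M : ℕ}

/-- The Hessian at `x`, as an operator; its operator norm is the 2-norm of the Hessian matrix. -/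
def hessian (f : Vec M → ℝ) (x : Vec M) : Vec M →L[ℝ] Vec M := fderiv ℝ (gradient f) x

/-- The costs are convex and twice differentiable with bounded Hessians, and each sending
sub-network has at least one strongly convex cost. -/
structure CostConditions (subS : VS → Fin S) (J : VS ⊕ VR → Vec M → ℝ) : Prop where
  convex : ∀ k, ConvexOn ℝ Set.univ (J k)
  diff : ∀ k, Differentiable ℝ (J k)
  diff_gradient : ∀ k, Differentiable ℝ (gradient (J k))
  hessian_bounded : ∃ δ : ℝ, ∀ k x, ‖hessian (J k) x‖ ≤ δ
  strongly_convex : ∀ s, ∃ k : VS, subS k = s ∧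
    ∃ ν : ℝ, 0 < ν ∧ StrongConvexOn Set.univ ν (J (Sum.inl k))

/-- `wS s` solves `∑_k q_k ∇J_k(w) = 0`, the sum being over the agents of sub-network `s`. -/
def IsParetoSolution [Fintype VS] (subS : VS → Fin S) (J : VS ⊕ VR → Vec M → ℝ) (q : VS → ℝ)
    (wS : Fin S → Vec M) : Prop :=
  ∀ s, ∑ k with subS k = s, q k • gradient (J (Sum.inl k)) (wS s) = 0

/-- Smoothness of the Hessians at the limit points `wstar k`. -/
def HessianSmoothAt {V : Type*} (J : V → Vec M → ℝ) (wstar : V → Vec M) (κ ε : ℝ) : Prop :=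
  ∀ k, ∀ Δ : Vec M, ‖Δ‖ ≤ ε →
    ‖hessian (J k) (wstar k + Δ) - hessian (J k) (wstar k)‖ ≤ κ * ‖Δ‖

end Costs

/-! ### The diffusion strategy, its error recursion and the long-term model -/

section Dynamics

variable {V Ω : Type*} {M : ℕ}

/-- The gradient noise `s_{k,i+1}(w_{k,i})`, the approximate gradient minus the true one; here
`g k (i + 1)` is the approximate gradient that agent `k` uses at time `i + 1`. -/
def gradNoise (J : V → Vec M → ℝ) (w g : V → ℕ → Ω → Vec M) (k : V) (i : ℕ) (ω : Ω) : Vec M :=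
  g k (i + 1) ω - gradient (J k) (w k i ω)

/-- The σ-algebra generated by the iterates `w_{ℓ,j}`, `j ≤ i`, of all agents `ℓ`. -/
@[reducible] def pastSigma (w : V → ℕ → Ω → Vec M) (i : ℕ) : MeasurableSpace Ω :=
  ⨆ (ℓ : V) (j : ℕ) (_ : j ≤ i), MeasurableSpace.comap (w ℓ j) inferInstance

/-- The intermediate iterate `ψ_{k,i+1} = w_{k,i} - μ_k · (approximate gradient)`. -/
def adapt (stepsize : V → ℝ) (w g : V → ℕ → Ω → Vec M) (k : V) (i : ℕ) (ω : Ω) : Vec M :=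
  w k i ω - stepsize k • g k (i + 1) ω

/-- The iterates `w` follow the adapt-then-combine diffusion strategy, driven by the approximate
gradients `g`; time starts at `0` with initial iterates of finite fourth moment. -/
structure IsDiffusion [Fintype V] [MeasurableSpace Ω] (P : Measure Ω) (A : Matrix V V ℝ)
    (stepsize : V → ℝ) (w g : V → ℕ → Ω → Vec M) : Prop where
  measurable : ∀ k i, Measurable (w k i)
  initial : ∀ k, MemLp (w k 0) 4 P
  combine : ∀ k i ω, w k (i + 1) ω = ∑ ℓ, A ℓ k • adapt stepsize w g ℓ i ω

/-- First- and fourth-order conditional moment conditions on the gradient noise.  The field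
`memLp` only makes sure that the conditional expectations are the genuine ones. -/
structure NoiseConditions [MeasurableSpace Ω] (P : Measure Ω) (J : V → Vec M → ℝ)
    (w g : V → ℕ → Ω → Vec M) (β σ : V → ℝ) : Prop where
  memLp : ∀ k i, MemLp (gradNoise J w g k i) 4 P
  zero_mean : ∀ k i, P[gradNoise J w g k i | pastSigma w i] =ᵐ[P] 0
  fourth_moment : ∀ k i,
    P[fun ω => ‖gradNoise J w g k i ω‖ ^ 4 | pastSigma w i]
      ≤ᵐ[P] fun ω => β k ^ 4 * ‖w k i ω‖ ^ 4 + σ k ^ 4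

/-- The error vectors `w_k^⋆ - w_{k,i}`. -/
def errorVec (wstar : V → Vec M) (w : V → ℕ → Ω → Vec M) (k : V) (i : ℕ) (ω : Ω) : Vec M :=
  wstar k - w k i ω

/-- The averaged Hessian `∫₀¹ ∇²J_k(w_k^⋆ - t e) dt` at the error `e`. -/
def avgHessian (J : V → Vec M → ℝ) (wstar : V → Vec M) (k : V) (e : Vec M) : Vec M →L[ℝ] Vec M :=
  ∫ t in (0 : ℝ)..1, hessian (J k) (wstar k - t • e)

/-- The `k`-th block of `𝒜ᵀ ℳ s - 𝒜ᵀ ℳ b + 𝒜ᵀ (I - ℳ ℋ) e`, where `b_ℓ = -∇J_ℓ(w_ℓ^⋆)` and `ℋ` is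
block diagonal with blocks `H ℓ`. -/
def errorStep [Fintype V] (A : Matrix V V ℝ) (J : V → Vec M → ℝ) (wstar : V → Vec M)
    (stepsize : V → ℝ) (H : V → Vec M →L[ℝ] Vec M) (s e : V → Vec M) (k : V) : Vec M :=
  ∑ ℓ, A ℓ k • stepsize ℓ • s ℓ
    - ∑ ℓ, A ℓ k • stepsize ℓ • (-gradient (J ℓ) (wstar ℓ))
    + ∑ ℓ, A ℓ k • (e ℓ - stepsize ℓ • H ℓ (e ℓ))

/-- The true, nonlinear error recursion: the Hessians are averaged and depend on the error. -/
def IsNonlinearErrorModel [Fintype V] (A : Matrix V V ℝ) (J : V → Vec M → ℝ) (wstar : V → Vec M)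
    (stepsize : V → ℝ) (s e : V → ℕ → Ω → Vec M) : Prop :=
  ∀ k i ω, e k (i + 1) ω = errorStep A J wstar stepsize
    (fun ℓ => avgHessian J wstar ℓ (e ℓ i ω)) (fun ℓ => s ℓ i ω) (fun ℓ => e ℓ i ω) k

/-- The long-term model: the same recursion, driven by the same noise, with the constant Hessians
`∇²J_k(w_k^⋆)`. -/
def IsLongTermModel [Fintype V] (A : Matrix V V ℝ) (J : V → Vec M → ℝ) (wstar : V → Vec M)
    (stepsize : V → ℝ) (s e : V → ℕ → Ω → Vec M) : Prop :=
  ∀ k i ω, e k (i + 1) ω = errorStep A J wstar stepsize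
    (fun ℓ => hessian (J ℓ) (wstar ℓ)) (fun ℓ => s ℓ i ω) (fun ℓ => e ℓ i ω) k

/-- `limsup_{i → ∞} E ‖x_i‖²` in `[0, ∞]`, for the network vector `x_i = col{x_{k,i}}` with its
Euclidean norm. -/
def limsupMeanSq [Fintype V] [MeasurableSpace Ω] (P : Measure Ω) (x : V → ℕ → Ω → Vec M) :
    ENNReal :=
  Filter.limsup (fun i : ℕ => ∫⁻ ω, ∑ k, ‖x k i ω‖ₑ ^ 2 ∂P) Filter.atTop

end Dynamics

end WeakNet

end

/-! Write `B` for the combination step `𝒜ᵀ`. The limit points are fixed by `B`, so the true error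
`x` obeys `x' = B (x - μ f x) + μ B z`, where `f` collects the gradients scaled by `-τ_k` as
functions of the error and `z` is the scaled noise. The long-term model replaces `f x` by `H x + f
0`, with `H` the scaled Hessians at the limit points.

Slow and fast parts. The Perron-weighted averages over the sending sub-networks, the centroids `C
x`, are invariant under `B`, and what remains after subtracting the limit vector of the centroids
contracts under `B` at a rate independent of `μ`. The contraction is a minorization argument: for
every agent, all members of some sending sub-network have positive weight in a common power of `A`
(`exists_contraction`). An adapted norm makes even a single step contract (`exists_deviation`). On
the centroids, the averaged field is strongly monotone, because one strongly convex cost per sending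
sub-network suffices when its agents agree. The bias `f 0` is not small, but its centroids vanish by
the Pareto condition. It therefore enters only the fast part and contributes order `μ²` to the
squared norm, not `μ`. Together these give a Euclidean norm `‖T ·‖` with `‖T B (x - μ f x)‖² ≤ (1 -
a μ) ‖T x‖² + O(μ²)` (`exists_drift`, `exists_lyapunov`).

Moments. Squaring the drift and using that the noise is conditionally centred gives a recursion for
`E ‖T x‖⁴` with contraction `1 - O(μ)` and input `O(μ³)`, hence `E ‖x‖⁴ = O(μ²)` eventually
(`exists_fourth_moment_bound`). In the difference `d` of the two models the noise and the bias
cancel. The recursion left is linear, contracts by the same theorem applied to `H`, and is driven by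
`μ` times a remainder `O(‖x‖²)`. Therefore `E ‖d‖² = O(μ²)` (`exists_second_moment_bound`). Since `E
‖x‖² = O(μ)`, the cross term in `‖x‖² - ‖x - d‖²` has mean `O(μ^{1/2} μ)`, which is the exponent
`3/2` (`meanSq_comparison`). -/

noncomputable section

namespace WeakNet

/-! ### Powers of left-stochastic matrices -/

section Stochastic

variable {V : Type*} [Fintype V] [DecidableEq V] {A : Matrix V V ℝ}

lemma pow_apply_nonneg (hA : ∀ i j, 0 ≤ A i j) (n : ℕ) (i j : V) : 0 ≤ (A ^ n) i j := by
  induction n generalizing j with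
  | zero => rw [pow_zero, Matrix.one_apply]; split_ifs <;> norm_num
  | succ n ih =>
    rw [pow_succ, Matrix.mul_apply]
    exact Finset.sum_nonneg fun k _ => mul_nonneg (ih k) (hA k j)

lemma pow_col_sum (hA : ∀ k, ∑ ℓ, A ℓ k = 1) (n : ℕ) (k : V) : ∑ ℓ, (A ^ n) ℓ k = 1 := by
  induction n generalizing k with
  | zero => simp [Matrix.one_apply]
  | succ n ih =>
    simp_rw [pow_succ, Matrix.mul_apply]
    rw [Finset.sum_comm]
    simp_rw [← Finset.sum_mul, ih, one_mul, hA]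

lemma pow_apply_pos_trans (hA : ∀ i j, 0 ≤ A i j) {m n : ℕ} {a b c : V}
    (hab : 0 < (A ^ m) a b) (hbc : 0 < (A ^ n) b c) : 0 < (A ^ (m + n)) a c := by
  rw [pow_add, Matrix.mul_apply]
  exact (mul_pos hab hbc).trans_le (Finset.single_le_sum
    (f := fun k => (A ^ m) a k * (A ^ n) k c)
    (fun k _ => mul_nonneg (pow_apply_nonneg hA _ _ _) (pow_apply_nonneg hA _ _ _))
    (Finset.mem_univ b))

lemma exists_pow_apply_pos (hA : ∀ i j, 0 ≤ A i j) {a b : V}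
    (h : Relation.ReflTransGen (fun a b => 0 < A a b) a b) : ∃ n, 0 < (A ^ n) a b := by
  induction h with
  | refl => exact ⟨0, by simp⟩
  | tail _ hbc ih =>
    obtain ⟨n, hn⟩ := ih
    exact ⟨n + 1, pow_apply_pos_trans hA hn (by simpa using hbc)⟩

lemma IsConnectedWithin.reflTransGen {V : Type*} {A : Matrix V V ℝ} {U : Set V} (h : IsConnectedWithin A U) {a b : V}
    (ha : a ∈ U) (hb : b ∈ U) : Relation.ReflTransGen (fun a b => 0 < A a b) a b :=
  Relation.ReflTransGen.mono (p := fun a b => 0 < A a b) (fun _ _ h => h.2.2) _ _ (h a ha b hb)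

/-- In a strongly connected set of agents all sufficiently long powers have positive entries. -/
lemma IsStronglyConnectedWithin.eventually_pos (hA : ∀ i j, 0 ≤ A i j) {U : Set V}
    (h : IsStronglyConnectedWithin A U) {a b : V} (ha : a ∈ U) (hb : b ∈ U) :
    ∀ᶠ n in Filter.atTop, 0 < (A ^ n) a b := by
  obtain ⟨hc, v, hv, hvv⟩ := h
  obtain ⟨m, hm⟩ := exists_pow_apply_pos hA (hc.reflTransGen ha hv)
  obtain ⟨n, hn⟩ := exists_pow_apply_pos hA (hc.reflTransGen hv hb)
  -- The self-loop at `v` pads a path through `v` to any larger length.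
  have hloop : ∀ j : ℕ, 0 < (A ^ j) v v := by
    intro j
    induction j with
    | zero => simp
    | succ j ih => exact pow_apply_pos_trans hA ih (by simpa using hvv)
  filter_upwards [Filter.eventually_ge_atTop (m + n)] with k hk
  have := pow_apply_pos_trans hA (pow_apply_pos_trans hA hm (hloop (k - (m + n)))) hn
  rwa [show m + (k - (m + n)) + n = k by omega] at this

end Stochastic

/-! ### The combination step -/

section Combine

variable {V : Type*} [Fintype V] {M : ℕ}

/-- The combination step `x ↦ 𝒜ᵀ x`. -/
def combineMap (A : Matrix V V ℝ) (M : ℕ) : (V → Vec M) →ₗ[ℝ] (V → Vec M) where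
  toFun x k := ∑ ℓ, A ℓ k • x ℓ
  map_add' x y := by ext1 k; simp [smul_add, Finset.sum_add_distrib]
  map_smul' c x := by ext1 k; simp [Finset.smul_sum, smul_comm c]

lemma combineMap_apply (A : Matrix V V ℝ) (x : V → Vec M) (k : V) :
    combineMap A M x k = ∑ ℓ, A ℓ k • x ℓ := rfl

lemma combineMap_pow_apply [DecidableEq V] (A : Matrix V V ℝ) (n : ℕ) (x : V → Vec M) (k : V) :
    (combineMap A M ^ n) x k = ∑ ℓ, (A ^ n) ℓ k • x ℓ := by
  induction n generalizing k with
  | zero => simp [Matrix.one_apply, ite_smul]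
  | succ n ih =>
    rw [pow_succ', Module.End.mul_apply, combineMap_apply]
    simp_rw [ih, pow_succ, Matrix.mul_apply, Finset.sum_smul, Finset.smul_sum, smul_smul]
    rw [Finset.sum_comm]
    simp_rw [mul_comm]

end Combine

/-! ### Weakly-connected networks -/

section Network

variable {VS VR : Type*} [Fintype VS] {S R M : ℕ}
  {A : Matrix (VS ⊕ VR) (VS ⊕ VR) ℝ} {subS : VS → Fin S} {subR : VR → Fin R} {p : VS → ℝ}

/-- The weighted averages `∑_{k ∈ s} p_k x_k` over the sending sub-networks. -/
def centroid (subS : VS → Fin S) (p : VS → ℝ) (M : ℕ) :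
    (VS ⊕ VR → Vec M) →ₗ[ℝ] (Fin S → Vec M) where
  toFun x s := ∑ k with subS k = s, p k • x (Sum.inl k)
  map_add' x y := by ext1 s; simp [smul_add, Finset.sum_add_distrib]
  map_smul' c x := by ext1 s; simp [Finset.smul_sum, smul_comm c]

lemma centroid_apply (subS : VS → Fin S) (p : VS → ℝ) (x : VS ⊕ VR → Vec M) (s : Fin S) :
    centroid subS p M x s = ∑ k with subS k = s, p k • x (Sum.inl k) := rfl

lemma IsPerronFamily.sum_mul (hp : IsPerronFamily A subS p) (ℓ : VS) :
    ∑ k, A (Sum.inl ℓ) (Sum.inl k) * p k = p ℓ := by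
  have := congrFun hp.1 ℓ
  simpa [Matrix.mulVec, dotProduct, Matrix.toBlocks₁₁] using this

variable [Fintype VR]

section

variable [DecidableEq VS] [DecidableEq VR]

/-- Positivity of long powers propagates along paths, so it is enough to trace each agent back to a
sending sub-network. For receiving agents this is a well-founded induction: by triangularity, the
link entering sub-network `r` from outside starts in group `S` or in a receiving sub-network of
smaller index. -/
lemma IsWeaklyConnectedNetwork.exists_sub_eventually_pos
    (hA : IsWeaklyConnectedNetwork A subS subR) (k : VS ⊕ VR) :
    ∃ s, ∀ j : VS, subS j = s → ∀ᶠ n in Filter.atTop, 0 < (A ^ n) (Sum.inl j) k := by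
  have hsend : ∀ k : VS, ∃ s, ∀ j : VS, subS j = s →
      ∀ᶠ n in Filter.atTop, 0 < (A ^ n) (Sum.inl j) (Sum.inl k) := fun k =>
    ⟨subS k, fun j hj => (hA.send_strong (subS k)).eventually_pos hA.nonneg ⟨j, rfl, hj⟩
      ⟨k, rfl, rfl⟩⟩
  have hext : ∀ a b : VS ⊕ VR, Relation.ReflTransGen (fun a b => 0 < A a b) a b →
      (∃ s, ∀ j : VS, subS j = s → ∀ᶠ n in Filter.atTop, 0 < (A ^ n) (Sum.inl j) a) →
      (∃ s, ∀ j : VS, subS j = s → ∀ᶠ n in Filter.atTop, 0 < (A ^ n) (Sum.inl j) b) := by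
    rintro a b hab ⟨s, hs⟩
    obtain ⟨m, hm⟩ := exists_pow_apply_pos hA.nonneg hab
    refine ⟨s, fun j hj => ?_⟩
    have h2 := (Filter.tendsto_sub_atTop_nat m).eventually (hs j hj)
    filter_upwards [h2, Filter.eventually_ge_atTop m] with n hn hmn
    have := pow_apply_pos_trans hA.nonneg hn hm
    rwa [Nat.sub_add_cancel hmn] at this
  have hrecv : ∀ r : Fin R, ∀ k : VR, subR k = r → ∃ s, ∀ j : VS, subS j = s →
      ∀ᶠ n in Filter.atTop, 0 < (A ^ n) (Sum.inl j) (Sum.inr k) := by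
    intro r
    induction r using WellFoundedLT.induction with
    | ind r ih =>
      intro k hk
      obtain ⟨_, ⟨k₀, rfl, hk₀⟩, ℓ, hℓ, hpos⟩ := hA.recv_receives r
      refine hext (Sum.inr k₀) _ ((hA.recv_connected r).reflTransGen ⟨k₀, rfl, hk₀⟩ ⟨k, rfl, hk⟩) ?_
      refine hext ℓ _ (Relation.ReflTransGen.single hpos) ?_
      rcases ℓ with ℓ | ℓ
      · exact hsend ℓ
      · have hne : subR ℓ ≠ r := fun h => hℓ ⟨ℓ, rfl, h⟩
        have hle : ¬ subR k₀ < subR ℓ := fun h => hpos.ne' (hA.recv_triangular ℓ k₀ h)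
        exact ih (subR ℓ) (lt_of_le_of_ne (hk₀ ▸ not_lt.mp hle) hne) ℓ rfl
  rcases k with k | k
  · exact hsend k
  · exact hrecv _ k rfl

/-- Finitely many eventual statements hold at one common exponent. The first positivity claim drives
the contraction, the second the positivity of the Perron vectors. -/
lemma IsWeaklyConnectedNetwork.exists_pow_pos (hA : IsWeaklyConnectedNetwork A subS subR) :
    ∃ n : ℕ, 1 ≤ n ∧ (∀ k, ∃ s, ∀ j : VS, subS j = s → 0 < (A ^ n) (Sum.inl j) k) ∧
      ∀ j k : VS, subS j = subS k → 0 < (A ^ n) (Sum.inl j) (Sum.inl k) := by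
  choose s hs using hA.exists_sub_eventually_pos
  have h1 : ∀ᶠ n in Filter.atTop, ∀ k, ∀ j : VS, subS j = s k → 0 < (A ^ n) (Sum.inl j) k := by
    simp only [Filter.eventually_all]
    exact hs
  have h2 : ∀ᶠ n in Filter.atTop, ∀ j k : VS, subS j = subS k →
      0 < (A ^ n) (Sum.inl j) (Sum.inl k) := by
    simp only [Filter.eventually_all]
    exact fun j k hjk => (hA.send_strong (subS k)).eventually_pos hA.nonneg ⟨j, rfl, hjk⟩
      ⟨k, rfl, rfl⟩
  obtain ⟨n, hn, hn1, hn2⟩ := ((Filter.eventually_ge_atTop 1).and (h1.and h2)).exists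
  exact ⟨n, hn, fun k => ⟨s k, hn1 k⟩, hn2⟩

end

/-- This is `A_s p_s = p_s` transposed: no weight enters a sending sub-network from other sending
sub-networks or from group `R`. -/
lemma IsWeaklyConnectedNetwork.centroid_combineMap (hA : IsWeaklyConnectedNetwork A subS subR)
    (hp : IsPerronFamily A subS p) (x : VS ⊕ VR → Vec M) :
    centroid subS p M (combineMap A M x) = centroid subS p M x := by
  ext1 s
  simp only [centroid_apply, combineMap_apply, Fintype.sum_sum_type, hA.no_feedback, zero_smul,
    Finset.sum_const_zero, add_zero, Finset.smul_sum, smul_smul]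
  rw [Finset.sum_comm]
  simp_rw [← Finset.sum_smul]
  rw [← Finset.sum_filter_add_sum_filter_not Finset.univ (fun k => subS k = s), add_eq_left.mpr]
  · refine Finset.sum_congr rfl fun ℓ hℓ => ?_
    congr 1
    rw [← hp.sum_mul ℓ, ← Finset.sum_filter_add_sum_filter_not Finset.univ (fun k => subS k = s)]
    rw [add_eq_left.mpr]
    · exact Finset.sum_congr rfl fun _ _ => mul_comm _ _
    · refine Finset.sum_eq_zero fun k hk => ?_
      rw [hA.send_diag, zero_mul]
      simp_all [eq_comm]
  · refine Finset.sum_eq_zero fun ℓ hℓ => ?_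
    rw [Finset.sum_eq_zero, zero_smul]
    intro k hk
    rw [hA.send_diag, mul_zero]
    simp_all

end Network

/-! ### Perron vectors, contraction modulo the centroids, invertibility of `I - T_RR` -/

section Perron

variable {VS VR : Type*} [Fintype VS] [Fintype VR] [DecidableEq VS] [DecidableEq VR] {S R : ℕ}
  {A : Matrix (VS ⊕ VR) (VS ⊕ VR) ℝ} {subS : VS → Fin S} {subR : VR → Fin R} {p : VS → ℝ}

lemma IsPerronFamily.sum_pow_mul (hA : IsWeaklyConnectedNetwork A subS subR)
    (hp : IsPerronFamily A subS p) (n : ℕ) (ℓ : VS) :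
    ∑ k, (A ^ n) (Sum.inl ℓ) (Sum.inl k) * p k = p ℓ := by
  induction n with
  | zero => simp [Matrix.one_apply]
  | succ n ih =>
    simp only [pow_succ, Matrix.mul_apply, Fintype.sum_sum_type, hA.no_feedback, mul_zero,
      Finset.sum_const_zero, add_zero, Finset.sum_mul]
    rw [Finset.sum_comm]
    simp_rw [mul_assoc, ← Finset.mul_sum, hp.sum_mul, ih]

/-- The Perron eigenvectors have positive entries. -/
lemma IsPerronFamily.pos (hA : IsWeaklyConnectedNetwork A subS subR)
    (hp : IsPerronFamily A subS p) (ℓ : VS) : 0 < p ℓ := by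
  obtain ⟨n, -, -, hn⟩ := hA.exists_pow_pos
  have hnn : ∀ i j, 0 ≤ (A ^ n) i j := pow_apply_nonneg hA.nonneg n
  -- The positive part `q` is subinvariant under the `n`-th power, which does not increase total
  -- mass. Hence `q` is invariant, and positivity spreads from one agent to its whole sub-network.
  set q : VS → ℝ := fun k => max (p k) 0
  have hq : ∀ k, 0 ≤ q k := fun k => le_max_right _ _
  have hle : ∀ ℓ, q ℓ ≤ ∑ k, (A ^ n) (Sum.inl ℓ) (Sum.inl k) * q k := by
    refine fun ℓ => max_le ?_ (Finset.sum_nonneg fun k _ => mul_nonneg (hnn _ _) (hq k))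
    rw [← hp.sum_pow_mul hA n ℓ]
    exact Finset.sum_le_sum fun k _ => mul_le_mul_of_nonneg_left (le_max_left _ _) (hnn _ _)
  have hsum : ∑ ℓ, ∑ k, (A ^ n) (Sum.inl ℓ) (Sum.inl k) * q k ≤ ∑ ℓ, q ℓ := by
    rw [Finset.sum_comm]
    refine Finset.sum_le_sum fun k _ => ?_
    rw [← Finset.sum_mul]
    refine mul_le_of_le_one_left (hq k) ?_
    rw [← pow_col_sum hA.col_sum n (Sum.inl k), Fintype.sum_sum_type]
    exact le_add_of_nonneg_right (Finset.sum_nonneg fun _ _ => hnn _ _)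
  have heq := (Finset.sum_eq_sum_iff_of_le (fun ℓ _ => hle ℓ)).mp
    (le_antisymm (Finset.sum_le_sum fun ℓ _ => hle ℓ) hsum)
  obtain ⟨k, hk, hpk⟩ : ∃ k ∈ Finset.univ.filter (fun k => subS k = subS ℓ), 0 < p k := by
    by_contra! h
    have := hp.2 (subS ℓ)
    have := Finset.sum_nonpos h
    linarith
  have h1 : 0 < q ℓ := by
    rw [heq ℓ (Finset.mem_univ ℓ)]
    refine (mul_pos (hn ℓ k (Finset.mem_filter.mp hk).2.symm) (lt_max_of_lt_left hpk)).trans_le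
      (Finset.single_le_sum (f := fun k => (A ^ n) (Sum.inl ℓ) (Sum.inl k) * q k)
        (fun k _ => mul_nonneg (hnn _ _) (hq k)) (Finset.mem_univ k))
  simpa [q] using h1

lemma IsPerronFamily.le_one (hA : IsWeaklyConnectedNetwork A subS subR)
    (hp : IsPerronFamily A subS p) (ℓ : VS) : p ℓ ≤ 1 := by
  rw [← hp.2 (subS ℓ)]
  exact Finset.single_le_sum (f := p) (fun k _ => (hp.pos hA k).le) (by simp)

/-- Some power of the combination matrix contracts the network vectors with vanishing
centroids. -/
lemma IsWeaklyConnectedNetwork.exists_contraction (hA : IsWeaklyConnectedNetwork A subS subR)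
    (hp : IsPerronFamily A subS p) :
    ∃ (n : ℕ) (q : ℝ), 1 ≤ n ∧ 0 ≤ q ∧ q < 1 ∧ ∀ (M : ℕ) (x : VS ⊕ VR → Vec M),
      centroid subS p M x = 0 → ‖(combineMap A M ^ n) x‖ ≤ q * ‖x‖ := by
  obtain ⟨n, hn1, hn, -⟩ := hA.exists_pow_pos
  choose s hs using hn
  have hδ : ∀ᶠ δ : ℝ in nhdsWithin 0 (Set.Ioi 0), (∀ k, ∀ j : VS, subS j = s k →
      δ ≤ (A ^ n) (Sum.inl j) k) ∧ δ ≤ 1 ∧ 0 < δ := by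
    refine .and ?_ (.and ?_ self_mem_nhdsWithin)
    · simp only [Filter.eventually_all]
      exact fun k j hj => (eventually_le_nhds (hs k j hj)).filter_mono nhdsWithin_le_nhds
    · exact (eventually_le_nhds one_pos).filter_mono nhdsWithin_le_nhds
  obtain ⟨δ, hδ, hδ1, hδ0⟩ := hδ.exists
  refine ⟨n, 1 - δ, hn1, by linarith, by linarith, fun M x hx => ?_⟩
  refine (pi_norm_le_iff_of_nonneg (mul_nonneg (by linarith) (norm_nonneg x))).mpr fun k => ?_
  -- Minorization: column `k` of `A ^ n` dominates `δ` times the Perron weights of sub-network `s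
  -- k`. Subtracting these changes nothing on vectors with vanishing centroids and leaves
  -- nonnegative weights of total mass `1 - δ`.
  set b : VS ⊕ VR → ℝ := Sum.elim (fun j => if subS j = s k then p j else 0) 0
  have hb0 : ∑ ℓ, b ℓ • x ℓ = 0 := by
    have := congrFun hx (s k)
    rw [centroid_apply, Finset.sum_filter] at this
    simpa [b, ite_smul] using this
  have hb1 : ∑ ℓ, b ℓ = 1 := by
    have := hp.2 (s k)
    rw [Finset.sum_filter] at this
    simpa [b] using this
  have hbnn : ∀ ℓ, 0 ≤ (A ^ n) ℓ k - δ * b ℓ := by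
    rintro (j | j)
    · by_cases hj : subS j = s k
      · have h1 := hδ k j hj
        have h2 := mul_le_mul_of_nonneg_left (hp.le_one hA j) hδ0.le
        simp only [b, Sum.elim_inl, hj, if_true]
        linarith
      · simpa [b, hj] using pow_apply_nonneg hA.nonneg n _ _
    · simpa [b] using pow_apply_nonneg hA.nonneg n _ _
  have heq : (combineMap A M ^ n) x k = ∑ ℓ, ((A ^ n) ℓ k - δ * b ℓ) • x ℓ := by
    simp_rw [combineMap_pow_apply, sub_smul, Finset.sum_sub_distrib, mul_smul,
      ← Finset.smul_sum, hb0, smul_zero, sub_zero]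
  rw [heq]
  calc ‖∑ ℓ, ((A ^ n) ℓ k - δ * b ℓ) • x ℓ‖
      ≤ ∑ ℓ, ((A ^ n) ℓ k - δ * b ℓ) * ‖x‖ := by
        refine (norm_sum_le _ _).trans (Finset.sum_le_sum fun ℓ _ => ?_)
        rw [norm_smul, Real.norm_of_nonneg (hbnn ℓ)]
        exact mul_le_mul_of_nonneg_left (norm_le_pi_norm x ℓ) (hbnn ℓ)
    _ = (1 - δ) * ‖x‖ := by
        rw [← Finset.sum_mul, Finset.sum_sub_distrib, ← Finset.mul_sum, hb1,
          pow_col_sum hA.col_sum, mul_one]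

/-- A left null vector of `I - T_RR`, extended by zero to group `S`, is fixed by the combination
step and has vanishing centroids, so the contraction forces it to be zero. -/
lemma IsWeaklyConnectedNetwork.isUnit_det (hA : IsWeaklyConnectedNetwork A subS subR)
    (hp : IsPerronFamily A subS p) : IsUnit (1 - A.toBlocks₂₂).det := by
  rw [isUnit_iff_ne_zero]
  intro h0
  obtain ⟨v, hv, hv0⟩ := Matrix.exists_vecMul_eq_zero_iff.mpr h0
  obtain ⟨n, q, -, -, hq1, hq⟩ := hA.exists_contraction hp
  set x : VS ⊕ VR → Vec 1 := Sum.elim 0 (fun k => v k • EuclideanSpace.single 0 1)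
  have hfix : combineMap A 1 x = x := by
    ext1 k
    rw [combineMap_apply, Fintype.sum_sum_type]
    rcases k with k | k
    · simp [x, hA.no_feedback]
    · have hk := congrFun hv0 k
      rw [Matrix.vecMul_sub, Matrix.vecMul_one, Pi.sub_apply, Pi.zero_apply, sub_eq_zero] at hk
      simp only [x, Sum.elim_inl, Sum.elim_inr, Pi.zero_apply, smul_zero, Finset.sum_const_zero,
        zero_add, smul_smul, ← Finset.sum_smul]
      congr 1
      rw [hk]
      exact Finset.sum_congr rfl fun _ _ => mul_comm _ _
  have hpow : (combineMap A 1 ^ n) x = x := by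
    rw [Module.End.pow_apply]
    exact Function.iterate_fixed hfix n
  have hx : x = 0 := by
    have := hq 1 x (by ext1 s; simp [centroid_apply, x])
    rw [hpow] at this
    have h2 := norm_nonneg x
    exact norm_eq_zero.mp (by nlinarith)
  refine hv (funext fun k => ?_)
  have := congrArg (fun u : Vec 1 => u 0) (congrFun hx (Sum.inr k))
  simpa [x] using this

end Perron

/-! ### Fixed vectors of the combination step and an adapted Euclidean norm -/

section Limit

variable {VS VR : Type*} [Fintype VS] [Fintype VR] [DecidableEq VR] {S R M : ℕ}
  {A : Matrix (VS ⊕ VR) (VS ⊕ VR) ℝ} {subS : VS → Fin S} {subR : VR → Fin R} {p : VS → ℝ}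

/-- `limitPoint` as a linear map. -/
def limitMap (A : Matrix (VS ⊕ VR) (VS ⊕ VR) ℝ) (subS : VS → Fin S) (M : ℕ) :
    (Fin S → Vec M) →ₗ[ℝ] (VS ⊕ VR → Vec M) where
  toFun := limitPoint A subS
  map_add' x y := by
    ext1 k
    rcases k with k | k <;> simp [limitPoint, Finset.sum_add_distrib]
  map_smul' c x := by
    ext1 k
    rcases k with k | k <;> simp [limitPoint, Finset.smul_sum, smul_comm c]

lemma limitMap_apply (c : Fin S → Vec M) : limitMap A subS M c = limitPoint A subS c := rfl

lemma centroid_limitMap (hp : IsPerronFamily A subS p) (c : Fin S → Vec M) :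
    centroid subS p M (limitMap A subS M c) = c := by
  ext1 s
  rw [centroid_apply]
  trans ∑ k with subS k = s, p k • c s
  · refine Finset.sum_congr rfl fun k hk => ?_
    rw [← (Finset.mem_filter.mp hk).2]
    rfl
  · rw [← Finset.sum_smul, hp.2 s, one_smul]

/-- The limit points are fixed by the combination step. -/
lemma IsWeaklyConnectedNetwork.combineMap_limitMap (hA : IsWeaklyConnectedNetwork A subS subR)
    (hp : IsPerronFamily A subS p) (c : Fin S → Vec M) :
    combineMap A M (limitMap A subS M c) = limitMap A subS M c := by
  classical
  ext1 k
  rw [combineMap_apply, Fintype.sum_sum_type]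
  rcases k with k | k
  · simp only [limitMap_apply, limitPoint, hA.no_feedback, zero_smul, Finset.sum_const_zero,
      add_zero]
    have hsum : ∑ ℓ : VS, A (Sum.inl ℓ) (Sum.inl k) = 1 := by
      simpa [Fintype.sum_sum_type, hA.no_feedback] using hA.col_sum (Sum.inl k)
    rw [← one_smul ℝ (c (subS k)), ← hsum, Finset.sum_smul]
    refine Finset.sum_congr rfl fun ℓ _ => ?_
    by_cases h : subS ℓ = subS k
    · rw [h]
    · rw [hA.send_diag ℓ k h, zero_smul, zero_smul]
  · simp only [limitMap_apply, limitPoint]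
    -- The defining equation `W (I - T_RR) = T_SR`, rewritten as the fixed-point equation of the
    -- receiving block.
    have hW : influence A = A.toBlocks₁₂ + influence A * A.toBlocks₂₂ := by
      have h1 : influence A * (1 - A.toBlocks₂₂) = A.toBlocks₁₂ := by
        rw [influence, Matrix.mul_assoc, Matrix.nonsing_inv_mul _ (hA.isUnit_det hp),
          Matrix.mul_one]
      rw [← h1, Matrix.mul_sub, Matrix.mul_one, sub_add_cancel]
    conv_rhs => rw [hW]
    simp only [Matrix.add_apply, add_smul, Finset.sum_add_distrib, Matrix.mul_apply,
      Finset.sum_smul, Finset.smul_sum, smul_smul]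
    congr 1
    rw [Finset.sum_comm]
    exact Finset.sum_congr rfl fun _ _ => Finset.sum_congr rfl fun _ _ => by
      rw [mul_comm]; rfl

/-- The deviation of a network vector from the limit vector of its centroids, measured in a
Euclidean norm in which the combination step contracts. -/
lemma IsWeaklyConnectedNetwork.exists_deviation (hA : IsWeaklyConnectedNetwork A subS subR)
    (hp : IsPerronFamily A subS p) (M : ℕ) :
    ∃ (N : ℕ) (r K : ℝ) (Y : (VS ⊕ VR → Vec M) →ₗ[ℝ]
        PiLp 2 (fun _ : Fin N × (VS ⊕ VR) => Vec M)), 0 ≤ r ∧ r < 1 ∧ 0 ≤ K ∧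
      (∀ x, ‖Y (combineMap A M x)‖ ≤ r * ‖Y x‖) ∧
      ∀ x, ‖x - limitMap A subS M (centroid subS p M x)‖ ≤ K * ‖Y x‖ := by
  classical
  obtain ⟨n, q, hn1, hq0, hq1, hq⟩ := hA.exists_contraction hp
  set B := combineMap A M
  set Q : (VS ⊕ VR → Vec M) →ₗ[ℝ] (VS ⊕ VR → Vec M) :=
    LinearMap.id - limitMap A subS M ∘ₗ centroid subS p M
  have hQ : ∀ x, Q x = x - limitMap A subS M (centroid subS p M x) := fun x => rfl
  have hCQ : ∀ x, centroid subS p M (Q x) = 0 := by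
    intro x; rw [hQ, map_sub, centroid_limitMap hp, sub_self]
  have hQB : ∀ x, Q (B x) = B (Q x) := by
    intro x
    rw [hQ, hQ, map_sub, hA.combineMap_limitMap hp, hA.centroid_combineMap hp]
  have hpow : ∀ m x, centroid subS p M x = 0 → ‖(B ^ (n * m)) x‖ ≤ q ^ m * ‖x‖ ∧
      centroid subS p M ((B ^ (n * m)) x) = 0 := by
    have hc : ∀ j x, centroid subS p M ((B ^ j) x) = centroid subS p M x := by
      intro j x
      induction j with
      | zero => simp
      | succ j ih => rw [pow_succ', Module.End.mul_apply, hA.centroid_combineMap hp, ih]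
    intro m x hx
    refine ⟨?_, (hc _ _).trans hx⟩
    induction m with
    | zero => simp
    | succ m ih =>
      rw [Nat.mul_succ, add_comm, pow_add, Module.End.mul_apply, pow_succ', mul_assoc]
      exact (hq M _ ((hc _ _).trans hx)).trans (mul_le_mul_of_nonneg_left ih hq0)
  set S2 : (VS ⊕ VR → Vec M) → ℝ := fun x => ∑ k, ‖x k‖ ^ 2
  have hS2nn : ∀ x, 0 ≤ S2 x := fun x => Finset.sum_nonneg fun _ _ => sq_nonneg _
  have hS2le : ∀ x, S2 x ≤ Fintype.card (VS ⊕ VR) * ‖x‖ ^ 2 := by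
    intro x
    have := Finset.sum_le_card_nsmul Finset.univ (fun k => ‖x k‖ ^ 2) (‖x‖ ^ 2) (fun k _ =>
      pow_le_pow_left₀ (norm_nonneg _) (norm_le_pi_norm x k) 2)
    simpa [S2, Finset.card_univ] using this
  have hleS2 : ∀ x, ‖x‖ ^ 2 ≤ S2 x := by
    intro x
    have : ‖x‖ ≤ √(S2 x) := (pi_norm_le_iff_of_nonneg (Real.sqrt_nonneg _)).mpr fun k =>
      Real.le_sqrt_of_sq_le (Finset.single_le_sum (f := fun k => ‖x k‖ ^ 2)
        (fun _ _ => sq_nonneg _) (Finset.mem_univ k))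
    calc ‖x‖ ^ 2 ≤ √(S2 x) ^ 2 := pow_le_pow_left₀ (norm_nonneg _) this 2
      _ = S2 x := Real.sq_sqrt (hS2nn x)
  -- Passing between the sup norm and the sum of squares costs a factor equal to the number of
  -- agents; `m` rounds of the contraction compensate for it.
  obtain ⟨m, hm1, hm⟩ : ∃ m : ℕ, 1 ≤ m ∧ (Fintype.card (VS ⊕ VR) : ℝ) * (q ^ m) ^ 2 ≤ 1 / 2 := by
    have h1 : Filter.Tendsto (fun m : ℕ => (Fintype.card (VS ⊕ VR) : ℝ) * (q ^ m) ^ 2)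
        Filter.atTop (nhds ((Fintype.card (VS ⊕ VR) : ℝ) * 0 ^ 2)) :=
      ((tendsto_pow_atTop_nhds_zero_of_lt_one hq0 hq1).pow 2).const_mul _
    have h2 := h1.eventually (eventually_le_nhds (b := 1 / 2) (by norm_num))
    obtain ⟨m, h3, h4⟩ := ((Filter.eventually_ge_atTop 1).and h2).exists
    exact ⟨m, h3, h4⟩
  set N := n * m
  have hN1 : 1 ≤ N := Nat.mul_pos hn1 hm1
  have hNR : (1 : ℝ) ≤ N := by exact_mod_cast hN1
  -- Bernoulli's inequality gives `r ^ (2 * N) ≥ 1 / 2`, so `N` steps contract the sum of squares at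
  -- least as fast as `r ^ 2` per step would.
  set r : ℝ := 1 - 1 / (4 * N) with hr
  have hinv : (1 : ℝ) / (4 * N) ≤ 1 / 4 := by
    apply one_div_le_one_div_of_le <;> linarith
  have hinv0 : (0 : ℝ) < 1 / (4 * N) := by positivity
  have hr0 : 0 < r := by rw [hr]; linarith
  have hrN : 1 / 2 ≤ (r ^ 2) ^ N := by
    rw [← pow_mul]
    have := one_add_mul_le_pow (a := -(1 / (4 * (N : ℝ)))) (by linarith) (2 * N)
    have h3 : 1 + ((2 * N : ℕ) : ℝ) * -(1 / (4 * (N : ℝ))) = 1 / 2 := by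
      push_cast; field_simp; ring
    rw [h3] at this
    rw [hr, sub_eq_add_neg]
    exact this
  have hdecay : ∀ x, S2 ((B ^ N) (Q x)) ≤ (r ^ 2) ^ N * S2 (Q x) := by
    intro x
    calc S2 ((B ^ N) (Q x)) ≤ Fintype.card (VS ⊕ VR) * ‖(B ^ N) (Q x)‖ ^ 2 := hS2le _
      _ ≤ Fintype.card (VS ⊕ VR) * (q ^ m * ‖Q x‖) ^ 2 := by
          gcongr; exact (hpow m _ (hCQ x)).1
      _ = (Fintype.card (VS ⊕ VR) * (q ^ m) ^ 2) * ‖Q x‖ ^ 2 := by ring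
      _ ≤ (r ^ 2) ^ N * S2 (Q x) := by
          exact mul_le_mul (hm.trans hrN) (hleS2 _) (sq_nonneg _) (by positivity)
  -- Adapted norm: the first `N` iterates of the deviation, weighted by `r⁻¹ ^ j`. One step shifts
  -- the sum and produces a factor `r ^ 2`; the new last term is at most the dropped first one by
  -- `hdecay`. The target is Euclidean because the later moment estimates need an inner product.
  let Y : (VS ⊕ VR → Vec M) →ₗ[ℝ] PiLp 2 (fun _ : Fin N × (VS ⊕ VR) => Vec M) :=
    { toFun := fun x => WithLp.toLp 2 fun i => (r⁻¹ ^ (i.1 : ℕ)) • (B ^ (i.1 : ℕ)) (Q x) i.2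
      map_add' := by intro x y; ext1 i; simp
      map_smul' := by intro c x; ext1 i; simp [smul_comm c] }
  have hYsq : ∀ x, ‖Y x‖ ^ 2 = ∑ j ∈ Finset.range N, ((r ^ 2)⁻¹) ^ j * S2 ((B ^ j) (Q x)) := by
    intro x
    rw [PiLp.norm_sq_eq_of_L2, Fintype.sum_prod_type, Finset.sum_range]
    refine Finset.sum_congr rfl fun j _ => ?_
    rw [Finset.mul_sum]
    refine Finset.sum_congr rfl fun k _ => ?_
    simp only [Y, LinearMap.coe_mk, AddHom.coe_mk, norm_smul, mul_pow]
    rw [norm_pow, Real.norm_of_nonneg (inv_nonneg.mpr hr0.le), ← pow_mul, mul_comm (j : ℕ) 2,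
      pow_mul, inv_pow]
  refine ⟨N, r, 1, Y, hr0.le, by rw [hr]; linarith, zero_le_one, fun x => ?_, fun x => ?_⟩
  · refine (pow_le_pow_iff_left₀ (norm_nonneg _) (by positivity) two_ne_zero).mp ?_
    set a : ℕ → ℝ := fun j => ((r ^ 2)⁻¹) ^ j * S2 ((B ^ j) (Q x))
    have h1 : ‖Y (B x)‖ ^ 2 = r ^ 2 * ∑ j ∈ Finset.range N, a (j + 1) := by
      rw [hYsq, Finset.mul_sum]
      refine Finset.sum_congr rfl fun j _ => ?_
      simp only [a]
      rw [hQB, ← Module.End.mul_apply, ← pow_succ, pow_succ (r ^ 2)⁻¹]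
      field_simp
    have h2 : ‖Y x‖ ^ 2 = ∑ j ∈ Finset.range N, a j := hYsq x
    have h3 : a N ≤ a 0 := by
      simp only [a, pow_zero, one_mul, Module.End.one_apply]
      rw [inv_pow, inv_mul_le_iff₀ (by positivity)]
      exact hdecay x
    have h4 := Finset.sum_range_succ a N
    rw [Finset.sum_range_succ'] at h4
    rw [h1, mul_pow, h2]
    exact mul_le_mul_of_nonneg_left (by linarith) (sq_nonneg r)
  · rw [one_mul, ← hQ]
    refine (pow_le_pow_iff_left₀ (norm_nonneg _) (norm_nonneg _) two_ne_zero).mp ?_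
    rw [hYsq]
    refine (hleS2 _).trans ?_
    refine le_trans ?_ (Finset.single_le_sum
      (f := fun j => ((r ^ 2)⁻¹) ^ j * S2 ((B ^ j) (Q x)))
      (fun j _ => mul_nonneg (by positivity) (hS2nn _)) (Finset.mem_range.mpr hN1))
    simp

end Limit

open scoped InnerProductSpace

/-! ### Drift of a slow-fast Lyapunov function -/

section Drift

/-- Convexity of the square for `r y + (1 - r) (z / (1 - r))`. The factor `1 / (1 - r)` is constant
for the fast part, but is of order `1 / μ` when `r = 1 - a μ`. -/
lemma sq_add_le_of_convex {r y z : ℝ} (hr0 : 0 ≤ r) (hr1 : r < 1) :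
    (r * y + z) ^ 2 ≤ r * y ^ 2 + z ^ 2 / (1 - r) := by
  have h : 0 < 1 - r := by linarith
  have key : r * y ^ 2 + z ^ 2 / (1 - r) - (r * y + z) ^ 2
      = r * ((1 - r) * y - z) ^ 2 / (1 - r) := by
    field_simp; ring
  have : 0 ≤ r * ((1 - r) * y - z) ^ 2 / (1 - r) := by positivity
  linarith

lemma sq_add_le_of_pos {t u v : ℝ} (ht : 0 < t) :
    (u + v) ^ 2 ≤ (1 + t) * u ^ 2 + (1 + 1 / t) * v ^ 2 := by
  have key : (1 + t) * u ^ 2 + (1 + 1 / t) * v ^ 2 - (u + v) ^ 2 = (t * u - v) ^ 2 / t := by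
    field_simp; ring
  have : 0 ≤ (t * u - v) ^ 2 / t := by positivity
  linarith

lemma sq_sum_three_le (k₃ k₄ k₅ c y b : ℝ) : (k₃ * c + k₄ * y + k₅ * b) ^ 2
    ≤ 3 * (k₃ ^ 2 + k₄ ^ 2 + k₅ ^ 2) * (c ^ 2 + y ^ 2 + b ^ 2) := by
  have h2 : (k₃ * c + k₄ * y + k₅ * b) ^ 2
      ≤ 3 * ((k₃ * c) ^ 2 + (k₄ * y) ^ 2 + (k₅ * b) ^ 2) := by
    linarith [sq_nonneg (k₃ * c - k₄ * y), sq_nonneg (k₃ * c - k₅ * b),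
      sq_nonneg (k₄ * y - k₅ * b)]
  have h3 : 0 ≤ k₃ ^ 2 * (y ^ 2 + b ^ 2) + k₄ ^ 2 * (c ^ 2 + b ^ 2)
      + k₅ ^ 2 * (c ^ 2 + y ^ 2) := by positivity
  linarith

/-- Young's inequality with weight `ν μ / 2` spends half of the contraction; the perturbation, of
order `μ² / μ`, keeps one factor `μ`. -/
lemma sq_slow_le {u y c ν μ k₁ : ℝ} (hν : 0 < ν) (hμ : 0 < μ) (hμ1 : μ ≤ 1)
    (hu : u ^ 2 ≤ (1 - ν * μ) * c ^ 2) :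
    (u + μ * k₁ * y) ^ 2
      ≤ (1 - ν / 2 * μ) * c ^ 2 + μ * ((1 + 2 / ν) * k₁ ^ 2) * y ^ 2 := by
  have h2 := sq_add_le_of_pos (u := u) (v := μ * k₁ * y) (show 0 < ν * μ / 2 by positivity)
  have h3 : (1 + ν * μ / 2) * u ^ 2 ≤ (1 + ν * μ / 2) * ((1 - ν * μ) * c ^ 2) :=
    mul_le_mul_of_nonneg_left hu (by positivity)
  have h4 : (1 + 1 / (ν * μ / 2)) * (μ * k₁ * y) ^ 2
      ≤ μ * ((1 + 2 / ν) * k₁ ^ 2) * y ^ 2 := by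
    have : (1 + 1 / (ν * μ / 2)) * (μ * k₁ * y) ^ 2
        = μ * ((μ + 2 / ν) * k₁ ^ 2) * y ^ 2 := by
      field_simp
    rw [this]
    refine mul_le_mul_of_nonneg_right (mul_le_mul_of_nonneg_left ?_ hμ.le) (sq_nonneg y)
    exact mul_le_mul_of_nonneg_right (by linarith) (sq_nonneg k₁)
  have h5 : 0 ≤ (ν * μ) ^ 2 * c ^ 2 := by positivity
  linarith

/-- The contraction margin `1 - r` does not depend on `μ`, so the bias `b` enters at order `μ²`. -/
lemma sq_fast_le {r y c b μ k₃ k₄ k₅ : ℝ} (hr0 : 0 ≤ r) (hr1 : r < 1) (hμ : 0 < μ)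
    (hμ1 : μ ≤ 1) {k₆ : ℝ} (hk₆ : k₆ = 3 * (k₃ ^ 2 + k₄ ^ 2 + k₅ ^ 2) / (1 - r)) :
    (r * y + μ * (k₃ * c + k₄ * y + k₅ * b)) ^ 2
      ≤ (r + μ * k₆) * y ^ 2 + μ ^ 2 * k₆ * c ^ 2 + μ ^ 2 * k₆ * b ^ 2 := by
  have hr : 0 < 1 - r := by linarith
  have hk₆0 : 0 ≤ k₆ := by rw [hk₆]; positivity
  refine (sq_add_le_of_convex hr0 hr1).trans ?_
  have h4 : (μ * (k₃ * c + k₄ * y + k₅ * b)) ^ 2 / (1 - r)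
      ≤ μ ^ 2 * k₆ * (c ^ 2 + y ^ 2 + b ^ 2) := by
    rw [mul_pow, div_le_iff₀ hr, hk₆]
    refine (mul_le_mul_of_nonneg_left (sq_sum_three_le k₃ k₄ k₅ c y b) (sq_nonneg μ)).trans
      (le_of_eq ?_)
    field_simp
  have h5 : μ ^ 2 * k₆ * y ^ 2 ≤ μ * k₆ * y ^ 2 := by
    refine mul_le_mul_of_nonneg_right (mul_le_mul_of_nonneg_right ?_ hk₆0) (sq_nonneg y)
    rw [sq]
    exact mul_le_of_le_one_right hμ.le hμ1
  linarith

variable {X F₁ F₂ : Type*} [NormedAddCommGroup X] [NormedSpace ℝ X] [NormedAddCommGroup F₁]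
  [InnerProductSpace ℝ F₁] [NormedAddCommGroup F₂] [NormedSpace ℝ F₂]

/-- The slow component `C` contracts by the strong monotonicity of the averaged field, the fast
component `Y` by the linear map `B`. -/
theorem exists_drift (B : X →L[ℝ] X) (C : X →L[ℝ] F₁) (Y : X →L[ℝ] F₂) (ι : F₁ →L[ℝ] X)
    {r K : ℝ} (hr0 : 0 ≤ r) (hr1 : r < 1) (hK : 0 ≤ K) (hC : ∀ x, C (B x) = C x)
    (hY : ∀ x, ‖Y (B x)‖ ≤ r * ‖Y x‖) (hι : ∀ x, ‖x - ι (C x)‖ ≤ K * ‖Y x‖)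
    {f : X → X} {L ν : ℝ} (hL0 : 0 ≤ L) (hL : ∀ x y, ‖f x - f y‖ ≤ L * ‖x - y‖)
    (hf0 : C (f 0) = 0) (hν : 0 < ν) (hmono : ∀ c, ν * ‖c‖ ^ 2 ≤ ⟪c, C (f (ι c))⟫_ℝ) :
    ∃ a K' μ₀ : ℝ, 0 < a ∧ 0 ≤ K' ∧ 0 < μ₀ ∧
      ∀ μ, 0 < μ → μ ≤ μ₀ → ∀ x,
        ‖C (B (x - μ • f x))‖ ^ 2 + ‖Y (B (x - μ • f x))‖ ^ 2
          ≤ (1 - a * μ) * (‖C x‖ ^ 2 + ‖Y x‖ ^ 2) + K' * ‖f 0‖ ^ 2 * μ ^ 2 := by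
  set L₁ := ‖C‖ * (L * ‖ι‖)
  set k₁ := ‖C‖ * (L * K)
  set k₂ := (1 + 2 / ν) * k₁ ^ 2
  set k₃ := ‖Y‖ * (L * ‖ι‖)
  set k₄ := ‖Y‖ * (L * K)
  set k₅ := ‖Y‖
  have hr : 0 < 1 - r := by linarith
  set k₆ := 3 * (k₃ ^ 2 + k₄ ^ 2 + k₅ ^ 2) / (1 - r) with hk₆def
  have hk₂ : 0 ≤ k₂ := by positivity
  have hk₆ : 0 ≤ k₆ := by positivity
  -- One sum dominating every constant, so that `μ ≤ m / k₇` yields all the smallness conditions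
  -- `e1` to `e4`.
  set k₇ := k₆ + k₂ + ν + L₁ ^ 2 + 1
  have hk₇ : 0 < k₇ := by positivity
  set m := min 1 (min (ν / 4) (1 - r))
  have hm : 0 < m := lt_min one_pos (lt_min (by linarith) hr)
  have hm1 : m ≤ 1 := min_le_left _ _
  have hm2 : m ≤ ν / 4 := (min_le_right _ _).trans (min_le_left _ _)
  have hm3 : m ≤ 1 - r := (min_le_right _ _).trans (min_le_right _ _)
  have hle : ∀ {k μ : ℝ}, k ≤ k₇ → 0 < μ → μ ≤ m / k₇ → k * μ ≤ m := by
    intro k μ hk hμ hμ0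
    calc k * μ ≤ k₇ * μ := mul_le_mul_of_nonneg_right hk hμ.le
      _ ≤ k₇ * (m / k₇) := mul_le_mul_of_nonneg_left hμ0 hk₇.le
      _ = m := mul_div_cancel₀ m hk₇.ne'
  have hL₁ : 0 ≤ L₁ ^ 2 := sq_nonneg _
  have hmk : 0 < m / k₇ := div_pos hm hk₇
  refine ⟨ν / 4, k₆, m / k₇, by linarith, hk₆, hmk, fun μ hμ hμ0 x => ?_⟩
  have e1 : L₁ ^ 2 * μ ≤ ν / 4 := (hle (by linarith) hμ hμ0).trans hm2
  have e2 : k₆ * μ ≤ ν / 4 := (hle (by linarith) hμ hμ0).trans hm2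
  have e3 : (k₆ + k₂ + ν) * μ ≤ 1 - r := (hle (by linarith) hμ hμ0).trans hm3
  have e4 : 1 * μ ≤ 1 := (hle (by linarith) hμ hμ0).trans hm1
  set c := ‖C x‖
  set y := ‖Y x‖
  set b := ‖f 0‖
  have hc : 0 ≤ c := norm_nonneg _
  have hy : 0 ≤ y := norm_nonneg _
  have hfι : ‖C (f (ι (C x)))‖ ≤ L₁ * c := by
    rw [← sub_zero (C (f (ι (C x)))), ← hf0, ← map_sub]
    calc ‖C (f (ι (C x)) - f 0)‖ ≤ ‖C‖ * (L * (‖ι‖ * c)) :=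
          C.le_opNorm_of_le ((hL _ _).trans (mul_le_mul_of_nonneg_left
            (by rw [sub_zero]; exact ι.le_opNorm _) hL0))
      _ = L₁ * c := by ring
  -- Gradient descent on the centroids: monotonicity gives `-2 ν μ`, and `e1` absorbs the quadratic
  -- term.
  have hu : ‖C x - μ • C (f (ι (C x)))‖ ^ 2 ≤ (1 - ν * μ) * c ^ 2 := by
    have h1 := hmono (C x)
    have h2 : ‖C (f (ι (C x)))‖ ^ 2 ≤ L₁ ^ 2 * c ^ 2 := by
      rw [← mul_pow]; exact pow_le_pow_left₀ (norm_nonneg _) hfι 2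
    rw [norm_sub_sq_real, inner_smul_right, norm_smul, mul_pow, Real.norm_of_nonneg hμ.le]
    have h3 := mul_le_mul_of_nonneg_left h1 hμ.le
    have h4 := mul_le_mul_of_nonneg_left h2 (sq_nonneg μ)
    have h5 := mul_le_mul_of_nonneg_right e1 (mul_nonneg hμ.le (sq_nonneg c))
    have h6 : 0 ≤ ν * (μ * c ^ 2) := by positivity
    linarith
  have hCx : ‖C (B (x - μ • f x))‖ ≤ ‖C x - μ • C (f (ι (C x)))‖ + μ * k₁ * y := by
    rw [hC, map_sub, map_smul]
    have : C x - μ • C (f x) = (C x - μ • C (f (ι (C x)))) - μ • C (f x - f (ι (C x))) := by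
      rw [map_sub, smul_sub]; abel
    rw [this]
    refine (norm_sub_le _ _).trans (add_le_add_right ?_ _)
    rw [norm_smul, Real.norm_of_nonneg hμ.le, mul_assoc]
    refine mul_le_mul_of_nonneg_left ?_ hμ.le
    calc ‖C (f x - f (ι (C x)))‖ ≤ ‖C‖ * (L * (K * y)) :=
          C.le_opNorm_of_le ((hL _ _).trans (mul_le_mul_of_nonneg_left (hι x) hL0))
      _ = k₁ * y := by ring
  have hCsq := (pow_le_pow_left₀ (norm_nonneg _) hCx 2).trans
    (sq_slow_le hν hμ (by linarith) hu)
  have hx : ‖x‖ ≤ ‖ι‖ * c + K * y := by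
    calc ‖x‖ = ‖ι (C x) + (x - ι (C x))‖ := by rw [add_sub_cancel]
      _ ≤ ‖ι (C x)‖ + ‖x - ι (C x)‖ := norm_add_le _ _
      _ ≤ _ := add_le_add (ι.le_opNorm _) (hι x)
  have hfx : ‖Y (f x)‖ ≤ k₃ * c + k₄ * y + k₅ * b := by
    have h1 : ‖f x‖ ≤ L * (‖ι‖ * c + K * y) + b := by
      calc ‖f x‖ = ‖(f x - f 0) + f 0‖ := by rw [sub_add_cancel]
        _ ≤ ‖f x - f 0‖ + ‖f 0‖ := norm_add_le _ _
        _ ≤ _ := by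
          refine add_le_add_left ((hL x 0).trans ?_) _
          rw [sub_zero]
          exact mul_le_mul_of_nonneg_left hx hL0
    calc ‖Y (f x)‖ ≤ ‖Y‖ * (L * (‖ι‖ * c + K * y) + b) := Y.le_opNorm_of_le h1
      _ = _ := by simp only [k₃, k₄, k₅]; ring
  have hYx : ‖Y (B (x - μ • f x))‖ ≤ r * y + μ * (k₃ * c + k₄ * y + k₅ * b) := by
    refine (hY _).trans ?_
    rw [map_sub, map_smul]
    have h1 : ‖Y x - μ • Y (f x)‖ ≤ y + μ * (k₃ * c + k₄ * y + k₅ * b) := by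
      refine (norm_sub_le _ _).trans (add_le_add_right ?_ _)
      rw [norm_smul, Real.norm_of_nonneg hμ.le]
      exact mul_le_mul_of_nonneg_left hfx hμ.le
    have h2 : 0 ≤ μ * (k₃ * c + k₄ * y + k₅ * b) := by positivity
    have h3 := mul_le_mul_of_nonneg_left h1 hr0
    have h4 := mul_le_mul_of_nonneg_right hr1.le h2
    linarith
  have hYsq := (pow_le_pow_left₀ (norm_nonneg _) hYx 2).trans
    (sq_fast_le hr0 hr1 hμ (by linarith) hk₆def)
  -- In the sum, `c ^ 2` has coefficient `1 - ν μ / 2 + μ² k₆ ≤ 1 - ν μ / 4`, and `y ^ 2` has `r + μ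
  -- (k₆ + k₂) ≤ 1 - ν μ`.
  have f1 := mul_le_mul_of_nonneg_right e2 (mul_nonneg hμ.le (sq_nonneg c))
  have f2 := mul_le_mul_of_nonneg_right e3 (sq_nonneg y)
  have f3 : 0 ≤ ν * μ * y ^ 2 := by positivity
  linarith

end Drift

/-! ### Gradients and Hessians of convex costs -/

section Gradient

variable {M : ℕ} {f : Vec M → ℝ}

lemma inner_gradient_eq (f : Vec M → ℝ) (x v : Vec M) :
    ⟪gradient f x, v⟫_ℝ = fderiv ℝ f x v := by
  rw [gradient, InnerProductSpace.toDual_symm_apply]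

/-- The gradient of a strongly convex function is strongly monotone. -/
lemma _root_.StrongConvexOn.le_inner_gradient_sub {ν : ℝ} (hf : StrongConvexOn Set.univ ν f)
    (hd : Differentiable ℝ f) (x y : Vec M) :
    ν * ‖x - y‖ ^ 2 ≤ ⟪gradient f x - gradient f y, x - y⟫_ℝ := by
  -- Along the segment from `y` to `x` the function `f - ν / 2 ‖·‖²` is convex, so its derivative at
  -- `0` is at most its derivative at `1`.
  have hconv := (strongConvexOn_iff_convex.mp hf).comp_affineMap (AffineMap.lineMap (k := ℝ) y x)
  have hder : ∀ t : ℝ, HasDerivAt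
      ((fun x => f x - ν / 2 * ‖x‖ ^ 2) ∘ (AffineMap.lineMap (k := ℝ) y x))
      (⟪gradient f (AffineMap.lineMap y x t), x - y⟫_ℝ
        - ν * ⟪AffineMap.lineMap y x t, x - y⟫_ℝ) t := by
    intro t
    have h1 : HasDerivAt (AffineMap.lineMap y x : ℝ → Vec M) (x - y) t :=
      AffineMap.hasDerivAt_lineMap
    have h2 := ((hd _).hasFDerivAt.comp_hasDerivAt t h1).sub
      ((h1.norm_sq).const_mul (ν / 2))
    rw [inner_gradient_eq, show ∀ a : ℝ, ν * a = ν / 2 * (2 * a) by intro a; ring]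
    exact h2
  have hm := hconv.monotoneOn_deriv (fun t _ => (hder t).differentiableAt)
    (Set.mem_univ (0 : ℝ)) (Set.mem_univ (1 : ℝ)) zero_le_one
  rw [(hder 0).deriv, (hder 1).deriv] at hm
  simp only [AffineMap.lineMap_apply_zero, AffineMap.lineMap_apply_one] at hm
  rw [← real_inner_self_eq_norm_sq, inner_sub_left (gradient f x), inner_sub_left x]
  linarith

/-- The Hessian of a strongly convex function is positive definite. -/
lemma _root_.StrongConvexOn.le_inner_hessian {ν : ℝ} (hf : StrongConvexOn Set.univ ν f)
    (hd : Differentiable ℝ f) (hd2 : Differentiable ℝ (gradient f)) (x v : Vec M) :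
    ν * ‖v‖ ^ 2 ≤ ⟪v, hessian f x v⟫_ℝ := by
  have h1 : HasDerivAt (fun t : ℝ => gradient f (x + t • v)) (hessian f x v) 0 :=
    (hd2 x).hasFDerivAt.hasLineDerivAt v
  have h2 := h1.tendsto_slope_zero_right
  have h3 := (Filter.Tendsto.inner (𝕜 := ℝ) (tendsto_const_nhds (x := v)) h2)
  refine ge_of_tendsto h3 ?_
  filter_upwards [self_mem_nhdsWithin] with t ht
  have ht0 : (0 : ℝ) < t := ht
  have h4 := hf.le_inner_gradient_sub hd (x + t • v) x
  rw [add_sub_cancel_left, norm_smul, mul_pow, Real.norm_of_nonneg ht0.le, inner_smul_right,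
    real_inner_comm] at h4
  simp only [zero_add, zero_smul, add_zero, inner_smul_right]
  have h5 : ν * ‖v‖ ^ 2 * t ^ 2 ≤ t * ⟪v, gradient f (x + t • v) - gradient f x⟫_ℝ := by
    linarith
  rw [inv_mul_eq_div, le_div_iff₀ ht0]
  nlinarith

lemma norm_gradient_sub_le (hd2 : Differentiable ℝ (gradient f)) {δ : ℝ}
    (hδ : ∀ x, ‖hessian f x‖ ≤ δ) (x y : Vec M) :
    ‖gradient f x - gradient f y‖ ≤ δ * ‖x - y‖ :=
  convex_univ.norm_image_sub_le_of_norm_fderiv_le (𝕜 := ℝ) (fun x _ => hd2 x) (fun x _ => hδ x)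
    (Set.mem_univ y) (Set.mem_univ x)

/-- The Hessian need not be continuous; a derivative is measurable, and boundedness does the rest.
-/
lemma intervalIntegrable_hessian {δ : ℝ} (hδ : ∀ x, ‖hessian f x‖ ≤ δ) (w e : Vec M) :
    IntervalIntegrable (fun t : ℝ => hessian f (w - t • e)) volume 0 1 := by
  have hm : Measurable (hessian f) := measurable_fderiv ℝ (gradient f)
  refine (intervalIntegrable_const (c := δ)).mono_fun
    (hm.comp (by fun_prop)).aestronglyMeasurable (Filter.Eventually.of_forall fun t => ?_)
  exact (hδ _).trans (le_abs_self δ)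

variable {V : Type*} {J : V → Vec M → ℝ} {wstar : V → Vec M}

/-- The fundamental theorem of calculus along the segment from `wstar k` to `wstar k - e`. It turns
the averaged-Hessian recursion into one in terms of gradients. -/
lemma avgHessian_apply {k : V} (hd2 : Differentiable ℝ (gradient (J k))) {δ : ℝ}
    (hδ : ∀ x, ‖hessian (J k) x‖ ≤ δ) (e : Vec M) :
    avgHessian J wstar k e e = gradient (J k) (wstar k) - gradient (J k) (wstar k - e) := by
  rw [avgHessian, ContinuousLinearMap.intervalIntegral_apply (intervalIntegrable_hessian hδ _ _)]
  have hder : ∀ t ∈ Set.uIcc (0 : ℝ) 1, HasDerivAt (fun t : ℝ => -gradient (J k) (wstar k - t • e))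
      (hessian (J k) (wstar k - t • e) e) t := by
    intro t _
    have h1 : HasDerivAt (fun t : ℝ => wstar k - t • e) (-e) t := by
      simpa using ((hasDerivAt_id t).smul_const e).const_sub (wstar k)
    have h2 : HasDerivAt (fun t : ℝ => -gradient (J k) (wstar k - t • e))
        (-(hessian (J k) (wstar k - t • e) (-e))) t :=
      ((hd2 _).hasFDerivAt.comp_hasDerivAt t h1).neg
    rwa [map_neg, neg_neg] at h2
  rw [intervalIntegral.integral_eq_sub_of_hasDerivAt hder]
  · simp; abel
  · have := intervalIntegrable_hessian hδ (wstar k) e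
    exact ⟨(ContinuousLinearMap.apply ℝ (Vec M) e).integrable_comp this.1,
      (ContinuousLinearMap.apply ℝ (Vec M) e).integrable_comp this.2⟩

/-- The gradient at the limit point is linear up to an error of second order. -/
lemma norm_hessian_sub_avgHessian_le {κ ε : ℝ} (hκ : 0 ≤ κ) (hε : 0 < ε)
    (hsmooth : HessianSmoothAt J wstar κ ε) {δ : ℝ} {k : V}
    (hδ : ∀ x, ‖hessian (J k) x‖ ≤ δ) (e : Vec M) :
    ‖hessian (J k) (wstar k) e - avgHessian J wstar k e e‖ ≤ (κ + 2 * δ / ε) * ‖e‖ ^ 2 := by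
  have hδ0 : 0 ≤ δ := (norm_nonneg _).trans (hδ 0)
  have hb : ∀ t ∈ Set.uIoc (0 : ℝ) 1,
      ‖hessian (J k) (wstar k) - hessian (J k) (wstar k - t • e)‖ ≤ (κ + 2 * δ / ε) * ‖e‖ := by
    intro t ht
    rw [Set.uIoc_of_le zero_le_one] at ht
    -- Inside the `ε`-ball the Lipschitz condition applies; outside it the bound `2 δ` is at most `2
    -- δ / ε * ‖e‖`. The estimate is thus global.
    rcases le_total ‖e‖ ε with he | he
    · have h1 : ‖-(t • e)‖ ≤ ‖e‖ := by
        rw [norm_neg, norm_smul, Real.norm_of_nonneg ht.1.le]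
        exact mul_le_of_le_one_left (norm_nonneg _) ht.2
      have h2 := hsmooth k (-(t • e)) (h1.trans he)
      rw [norm_sub_rev, sub_eq_add_neg (wstar k)]
      refine h2.trans (mul_le_mul ?_ h1 (norm_nonneg _) (by positivity))
      have : 0 ≤ 2 * δ / ε := by positivity
      linarith
    · have h1 : ‖hessian (J k) (wstar k) - hessian (J k) (wstar k - t • e)‖ ≤ 2 * δ := by
        refine (norm_sub_le _ _).trans ?_
        linarith [hδ (wstar k), hδ (wstar k - t • e)]
      have h2 : 2 * δ ≤ 2 * δ / ε * ‖e‖ := by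
        rw [div_mul_eq_mul_div, le_div_iff₀ hε]
        exact mul_le_mul_of_nonneg_left he (by positivity)
      have h3 : 0 ≤ κ * ‖e‖ := by positivity
      linarith
  rw [← sub_apply]
  have heq : hessian (J k) (wstar k) - avgHessian J wstar k e
      = ∫ t in (0 : ℝ)..1, (hessian (J k) (wstar k) - hessian (J k) (wstar k - t • e)) := by
    rw [intervalIntegral.integral_sub intervalIntegrable_const (intervalIntegrable_hessian hδ _ _),
      intervalIntegral.integral_const, avgHessian]
    simp
  have h1 := intervalIntegral.norm_integral_le_of_norm_le_const hb
  rw [← heq, sub_zero, abs_one, mul_one] at h1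
  refine (ContinuousLinearMap.le_of_opNorm_le _ h1 e).trans (le_of_eq ?_)
  ring

end Gradient

/-! ### Moment estimates -/

section Moments

variable {F : Type*} [NormedAddCommGroup F] [InnerProductSpace ℝ F]

/-- Expand the square of `‖x‖² + 2 ⟪x, z⟫ + ‖z‖²`. The only term linear in `z` is kept as an inner
product, since it has mean zero for conditionally centred `z`. -/
lemma norm_add_pow_four_le (x z : F) :
    ‖x + z‖ ^ 4 ≤ ‖x‖ ^ 4 + 4 * ⟪‖x‖ ^ 2 • x, z⟫_ℝ + 8 * (‖x‖ ^ 2 * ‖z‖ ^ 2) + 3 * ‖z‖ ^ 4 := by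
  have h1 : ‖x + z‖ ^ 4 = (‖x‖ ^ 2 + 2 * ⟪x, z⟫_ℝ + ‖z‖ ^ 2) ^ 2 := by
    rw [← norm_add_sq_real]; ring
  have h2 : ⟪x, z⟫_ℝ ^ 2 ≤ ‖x‖ ^ 2 * ‖z‖ ^ 2 := by
    rw [← mul_pow, ← sq_abs]
    exact pow_le_pow_left₀ (abs_nonneg _) (abs_real_inner_le_norm x z) 2
  have h3 : 2 * ⟪x, z⟫_ℝ ≤ ‖x‖ ^ 2 + ‖z‖ ^ 2 := by
    nlinarith [real_inner_le_norm x z, sq_nonneg (‖x‖ - ‖z‖)]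
  have h4 := mul_le_mul_of_nonneg_right h3 (sq_nonneg ‖z‖)
  rw [h1, real_inner_smul_left]
  linarith

variable {Ω : Type*} {m mΩ : MeasurableSpace Ω} {P : Measure Ω}

lemma _root_.MeasureTheory.MemLp.integrable_pow_four {E : Type*} [NormedAddCommGroup E]
    {f : Ω → E} (hf : MemLp f 4 P) : Integrable (fun ω => ‖f ω‖ ^ 4) P :=
  MemLp.integrable_norm_pow (p := 4) (by exact_mod_cast hf) (by norm_num)

/-- The fourth moment grows only by terms of second order when a conditionally centred noise is
added. -/
lemma integral_norm_add_pow_four_le [CompleteSpace F] [IsProbabilityMeasure P] (hm : m ≤ mΩ)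
    {U Z : Ω → F} (hU : MemLp U 4 P) (hUm : StronglyMeasurable[m] U) (hZ : MemLp Z 4 P)
    (hZ0 : P[Z | m] =ᵐ[P] 0) {t : ℝ} (ht : 0 < t) :
    ∫ ω, ‖U ω + Z ω‖ ^ 4 ∂P
      ≤ (1 + t) * ∫ ω, ‖U ω‖ ^ 4 ∂P + (3 + 16 / t) * ∫ ω, ‖Z ω‖ ^ 4 ∂P := by
  have hU4 := hU.integrable_pow_four
  have hZ4 := hZ.integrable_pow_four
  have hVm : StronglyMeasurable[m] fun ω => ‖U ω‖ ^ 2 • U ω := (hUm.norm.pow 2).smul hUm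
  have hint : Integrable (fun ω => ⟪‖U ω‖ ^ 2 • U ω, Z ω⟫_ℝ) P := by
    refine (hU4.add hZ4).mono
      ((hVm.mono hm).aestronglyMeasurable.inner hZ.aestronglyMeasurable)
      (Filter.Eventually.of_forall fun ω => ?_)
    have h1 := norm_inner_le_norm (𝕜 := ℝ) (‖U ω‖ ^ 2 • U ω) (Z ω)
    rw [norm_smul, Real.norm_of_nonneg (sq_nonneg ‖U ω‖)] at h1
    refine h1.trans ?_
    rw [Pi.add_apply, Real.norm_of_nonneg (by positivity)]
    set a := ‖U ω‖
    set b := ‖Z ω‖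
    have ha : 0 ≤ a := norm_nonneg _
    have hb : 0 ≤ b := norm_nonneg _
    rcases le_total a b with h | h
    · have : a ^ 2 * a * b ≤ b ^ 2 * b * b := by gcongr
      have h4 : 0 ≤ a ^ 4 := by positivity
      linarith
    · have : a ^ 2 * a * b ≤ a ^ 2 * a * a := by gcongr
      have h4 : 0 ≤ b ^ 4 := by positivity
      linarith
  -- The left factor is `m`-measurable and comes out of the conditional expectation, where `Z`
  -- averages to zero.
  have hcross : ∫ ω, ⟪‖U ω‖ ^ 2 • U ω, Z ω⟫_ℝ ∂P = 0 := by
    have h1 := condExp_bilin_of_stronglyMeasurable_left (μ := P) (innerSL ℝ (E := F)) hVm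
      (g := Z) hint (hZ.integrable (by norm_num))
    rw [← integral_condExp hm]
    rw [← integral_zero Ω ℝ (μ := P)]
    refine integral_congr_ae ?_
    filter_upwards [h1, hZ0] with ω h2 h3
    refine h2.trans ?_
    rw [h3]
    simp
  have hpt : ∀ ω, ‖U ω + Z ω‖ ^ 4 ≤ (1 + t) * ‖U ω‖ ^ 4 + (3 + 16 / t) * ‖Z ω‖ ^ 4
      + 4 * ⟪‖U ω‖ ^ 2 • U ω, Z ω⟫_ℝ := by
    intro ω
    have h1 := norm_add_pow_four_le (U ω) (Z ω)
    have h2 : 8 * (‖U ω‖ ^ 2 * ‖Z ω‖ ^ 2) ≤ t * ‖U ω‖ ^ 4 + 16 / t * ‖Z ω‖ ^ 4 := by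
      have key : t * ‖U ω‖ ^ 4 + 16 / t * ‖Z ω‖ ^ 4 - 8 * (‖U ω‖ ^ 2 * ‖Z ω‖ ^ 2)
          = (t * ‖U ω‖ ^ 2 - 4 * ‖Z ω‖ ^ 2) ^ 2 / t := by
        field_simp; ring
      have : 0 ≤ (t * ‖U ω‖ ^ 2 - 4 * ‖Z ω‖ ^ 2) ^ 2 / t := by positivity
      linarith
    linarith
  calc ∫ ω, ‖U ω + Z ω‖ ^ 4 ∂P
      ≤ ∫ ω, ((1 + t) * ‖U ω‖ ^ 4 + (3 + 16 / t) * ‖Z ω‖ ^ 4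
          + 4 * ⟪‖U ω‖ ^ 2 • U ω, Z ω⟫_ℝ) ∂P :=
        integral_mono (hU.add hZ).integrable_pow_four
          (((hU4.const_mul _).add (hZ4.const_mul _)).add (hint.const_mul 4)) hpt
    _ = _ := by
        have hi : Integrable (fun ω => (1 + t) * ‖U ω‖ ^ 4 + (3 + 16 / t) * ‖Z ω‖ ^ 4) P :=
          (hU4.const_mul _).add (hZ4.const_mul _)
        rw [integral_add hi (hint.const_mul 4), integral_add (hU4.const_mul _) (hZ4.const_mul _)]
        simp only [integral_const_mul, hcross, mul_zero, add_zero]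

end Moments

section Recursion

/-- A contracting affine recursion is eventually close to its fixed point. -/
lemma eventually_le_of_affine_recursion {u : ℕ → ℝ} {t s η : ℝ} (ht0 : 0 < t) (ht1 : t ≤ 1)
    (h : ∀ᶠ i in Filter.atTop, u (i + 1) ≤ (1 - t) * u i + s) (hη : 0 < η) :
    ∀ᶠ i in Filter.atTop, u i ≤ s / t + η := by
  obtain ⟨i₀, hi₀⟩ := Filter.eventually_atTop.mp h
  have hn : ∀ n, u (i₀ + n) - s / t ≤ (1 - t) ^ n * (u i₀ - s / t) := by
    intro n
    induction n with
    | zero => simp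
    | succ n ih =>
      have h1 := hi₀ (i₀ + n) (by omega)
      have h2 := mul_le_mul_of_nonneg_left ih (show 0 ≤ 1 - t by linarith)
      have h3 : (1 - t) * (s / t) + s = s / t := by field_simp; ring
      rw [← add_assoc, pow_succ']
      linarith
  have hlim : Filter.Tendsto (fun n : ℕ => (1 - t) ^ n * (u i₀ - s / t)) Filter.atTop
      (nhds (0 * (u i₀ - s / t))) :=
    (tendsto_pow_atTop_nhds_zero_of_lt_one (by linarith) (by linarith)).mul_const _
  rw [zero_mul] at hlim
  have h1 := (Filter.tendsto_sub_atTop_nat i₀).eventually (hlim.eventually (eventually_le_nhds hη))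
  filter_upwards [h1, Filter.eventually_ge_atTop i₀] with i hi1 hi2
  have h2 := hn (i - i₀)
  rw [Nat.add_sub_cancel' hi2] at h2
  linarith

end Recursion

/-! ### Moment bounds for recursions with contraction rate of order `μ` -/

section StochasticRecursion

variable {X F : Type*} [NormedAddCommGroup X] [NormedSpace ℝ X] [NormedAddCommGroup F]
  [InnerProductSpace ℝ F]

/-- Fourth moment of a stochastic recursion `x' = Φ x + μ B z`, whose noiseless part contracts in
the norm `‖T ·‖` up to an offset of order `μ`. -/
theorem exists_fourth_moment_bound [CompleteSpace F] (B : X →L[ℝ] X) (T : X →L[ℝ] F) {a b K₁ K₂ : ℝ} (ha : 0 < a)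
    (hb : 0 ≤ b) (hT : ∀ x, ‖x‖ ≤ K₁ * ‖T x‖) (hK₂ : 0 ≤ K₂) :
    ∃ K μ₀ : ℝ, 0 ≤ K ∧ 0 < μ₀ ∧ ∀ μ, 0 < μ → μ ≤ μ₀ → ∀ Φ : X → X, Continuous Φ →
      (∀ x, ‖T (Φ x)‖ ^ 2 ≤ (1 - a * μ) * ‖T x‖ ^ 2 + b * μ ^ 2) →
      ∀ {Ω : Type*} [mΩ : MeasurableSpace Ω] (P : Measure Ω) [IsProbabilityMeasure P]
        (ℱ : ℕ → MeasurableSpace Ω) (x z : ℕ → Ω → X), (∀ i, ℱ i ≤ mΩ) →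
        (∀ i, MemLp (x i) 4 P) → (∀ i, MemLp (z i) 4 P) → (∀ i, StronglyMeasurable[ℱ i] (x i)) →
        (∀ i, P[fun ω => T (B (z i ω)) | ℱ i] =ᵐ[P] 0) →
        (∀ i, ∫ ω, ‖z i ω‖ ^ 4 ∂P ≤ K₂ * (∫ ω, ‖x i ω‖ ^ 4 ∂P + 1)) →
        (∀ i ω, x (i + 1) ω = Φ (x i ω) + μ • B (z i ω)) →
        ∀ᶠ i in Filter.atTop, ∫ ω, ‖x i ω‖ ^ 4 ∂P ≤ K * μ ^ 2 := by
  set k₃ := (‖T‖ * ‖B‖) ^ 4 * K₂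
  set k₄ := (3 + 32 / a) * k₃ * K₁ ^ 4 with hk₄def
  set k₅ := 2 * (b ^ 2 / a) + (3 + 32 / a) * k₃ with hk₅def
  have hk₃ : 0 ≤ k₃ := by positivity
  have hk₄ : 0 ≤ k₄ := by positivity
  have hk₅ : 0 ≤ k₅ := by positivity
  refine ⟨K₁ ^ 4 * (k₅ / (a / 4) + 1), min 1 (min (1 / a) (a / 4 / (k₄ + 1))), by positivity,
    lt_min one_pos (lt_min (by positivity) (by positivity)), ?_⟩
  intro μ hμ hμ0 Φ hΦc hΦ Ω mΩ P _ ℱ x z hℱ hx hz hxm hz0 hz4 hrec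
  have hμ1 : μ ≤ 1 := hμ0.trans (min_le_left _ _)
  have haμ : a * μ ≤ 1 := by
    have := hμ0.trans ((min_le_right _ _).trans (min_le_left _ _))
    rw [le_div_iff₀ ha] at this
    linarith
  have hkμ : k₄ * μ ≤ a / 4 := by
    have := hμ0.trans ((min_le_right _ _).trans (min_le_right _ _))
    rw [le_div_iff₀ (by positivity)] at this
    linarith
  have haμ0 : 0 < a * μ := by positivity
  set u : ℕ → ℝ := fun i => ∫ ω, ‖T (x i ω)‖ ^ 4 ∂P with hu
  have hTx : ∀ i, MemLp (fun ω => T (x i ω)) 4 P := fun i => T.comp_memLp' (hx i)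
  have hu0 : ∀ i, 0 ≤ u i := fun i => integral_nonneg fun ω => by positivity
  have hxu : ∀ i, ∫ ω, ‖x i ω‖ ^ 4 ∂P ≤ K₁ ^ 4 * u i := by
    intro i
    rw [hu, ← integral_const_mul]
    refine integral_mono (hx i).integrable_pow_four ((hTx i).integrable_pow_four.const_mul _)
      fun ω => ?_
    change ‖x i ω‖ ^ 4 ≤ K₁ ^ 4 * ‖T (x i ω)‖ ^ 4
    rw [← mul_pow]
    exact pow_le_pow_left₀ (norm_nonneg _) (hT _) 4
  have hstep : ∀ i, u (i + 1) ≤ (1 - a * μ / 4) * u i + k₅ * μ ^ 3 := by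
    intro i
    -- Squaring the drift by convexity turns the offset `b μ²` into `(b μ²)² / (a μ)`, of order
    -- `μ³`.
    have hUpt : ∀ ω, ‖T (Φ (x i ω))‖ ^ 4 ≤ (1 - a * μ) * ‖T (x i ω)‖ ^ 4 + b ^ 2 / a * μ ^ 3 := by
      intro ω
      have h1 := pow_le_pow_left₀ (sq_nonneg _) (hΦ (x i ω)) 2
      have h2 := sq_add_le_of_convex (r := 1 - a * μ) (y := ‖T (x i ω)‖ ^ 2) (z := b * μ ^ 2)
        (by linarith) (by linarith)
      have h3 : (b * μ ^ 2) ^ 2 / (1 - (1 - a * μ)) = b ^ 2 / a * μ ^ 3 := by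
        rw [sub_sub_cancel]; field_simp
      rw [h3] at h2
      calc ‖T (Φ (x i ω))‖ ^ 4 = (‖T (Φ (x i ω))‖ ^ 2) ^ 2 := by ring
        _ ≤ _ := h1.trans h2
        _ = _ := by ring
    have hUm : StronglyMeasurable[ℱ i] fun ω => T (Φ (x i ω)) :=
      (T.continuous.comp hΦc).comp_stronglyMeasurable (hxm i)
    have hU : MemLp (fun ω => T (Φ (x i ω))) 4 P := by
      refine ((hTx i).norm.add (memLp_const (b * μ ^ 2 + 1))).mono
        (hUm.mono (hℱ i)).aestronglyMeasurable (Filter.Eventually.of_forall fun ω => ?_)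
      rw [Pi.add_apply, Real.norm_of_nonneg (by positivity)]
      refine (pow_le_pow_iff_left₀ (norm_nonneg _) (by positivity) two_ne_zero).mp ?_
      have h1 := hΦ (x i ω)
      have h2 : (1 - a * μ) * ‖T (x i ω)‖ ^ 2 ≤ 1 * ‖T (x i ω)‖ ^ 2 :=
        mul_le_mul_of_nonneg_right (by linarith) (sq_nonneg _)
      have h3 : 0 ≤ b * μ ^ 2 := by positivity
      have h4 : 0 ≤ ‖T (x i ω)‖ * (b * μ ^ 2 + 1) := by positivity
      nlinarith
    have hZ : MemLp (fun ω => μ • T (B (z i ω))) 4 P :=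
      ((T.comp B).comp_memLp' (hz i)).const_smul μ
    have hZ0 : P[fun ω => μ • T (B (z i ω)) | ℱ i] =ᵐ[P] 0 := by
      refine (condExp_smul μ (fun ω => T (B (z i ω))) (ℱ i)).trans ?_
      filter_upwards [hz0 i] with ω hω
      rw [Pi.smul_apply, hω]
      simp
    -- The weight `a μ / 2` spends half of the contraction and costs a factor `O(1 / μ)` on noise of
    -- order `μ⁴`.
    have hmain := integral_norm_add_pow_four_le (hℱ i) hU hUm hZ hZ0
      (show 0 < a * μ / 2 by positivity)
    have heq : u (i + 1) = ∫ ω, ‖T (Φ (x i ω)) + μ • T (B (z i ω))‖ ^ 4 ∂P := by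
      simp only [hu, hrec, map_add, map_smul]
    have hUle : ∫ ω, ‖T (Φ (x i ω))‖ ^ 4 ∂P ≤ (1 - a * μ) * u i + b ^ 2 / a * μ ^ 3 := by
      calc ∫ ω, ‖T (Φ (x i ω))‖ ^ 4 ∂P
          ≤ ∫ ω, ((1 - a * μ) * ‖T (x i ω)‖ ^ 4 + b ^ 2 / a * μ ^ 3) ∂P :=
            integral_mono hU.integrable_pow_four
              (((hTx i).integrable_pow_four.const_mul _).add (integrable_const _)) hUpt
        _ = _ := by
            rw [integral_add ((hTx i).integrable_pow_four.const_mul _) (integrable_const _),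
              integral_const_mul]
            simp [hu]
    have hZle : ∫ ω, ‖μ • T (B (z i ω))‖ ^ 4 ∂P ≤ μ ^ 4 * (k₃ * (K₁ ^ 4 * u i + 1)) := by
      have h1 : ∀ ω, ‖μ • T (B (z i ω))‖ ^ 4 ≤ μ ^ 4 * (‖T‖ * ‖B‖) ^ 4 * ‖z i ω‖ ^ 4 := by
        intro ω
        rw [← mul_pow, ← mul_pow]
        refine pow_le_pow_left₀ (norm_nonneg _) ?_ 4
        rw [norm_smul, Real.norm_of_nonneg hμ.le, mul_assoc, mul_assoc]
        exact mul_le_mul_of_nonneg_left (T.le_opNorm_of_le (B.le_opNorm _)) hμ.le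
      calc ∫ ω, ‖μ • T (B (z i ω))‖ ^ 4 ∂P
          ≤ ∫ ω, μ ^ 4 * (‖T‖ * ‖B‖) ^ 4 * ‖z i ω‖ ^ 4 ∂P :=
            integral_mono hZ.integrable_pow_four ((hz i).integrable_pow_four.const_mul _) h1
        _ = μ ^ 4 * (‖T‖ * ‖B‖) ^ 4 * ∫ ω, ‖z i ω‖ ^ 4 ∂P := integral_const_mul _ _
        _ ≤ μ ^ 4 * (‖T‖ * ‖B‖) ^ 4 * (K₂ * (K₁ ^ 4 * u i + 1)) := by
            refine mul_le_mul_of_nonneg_left ((hz4 i).trans ?_) (by positivity)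
            exact mul_le_mul_of_nonneg_left (by linarith [hxu i]) hK₂
        _ = _ := by ring
    have e1 : (1 + a * μ / 2) * ((1 - a * μ) * u i + b ^ 2 / a * μ ^ 3)
        ≤ (1 - a * μ / 2) * u i + 2 * (b ^ 2 / a) * μ ^ 3 := by
      have h1 : 0 ≤ (a * μ) ^ 2 * u i := mul_nonneg (sq_nonneg _) (hu0 i)
      have h2 : a * μ * (b ^ 2 / a * μ ^ 3) ≤ 1 * (b ^ 2 / a * μ ^ 3) :=
        mul_le_mul_of_nonneg_right haμ (by positivity)
      have h3 : 0 ≤ b ^ 2 / a * μ ^ 3 := by positivity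
      nlinarith
    -- The noise grows with the state; for small `μ` this growth takes another `a μ / 4` from the
    -- contraction.
    have e2 : (3 + 16 / (a * μ / 2)) * (μ ^ 4 * (k₃ * (K₁ ^ 4 * u i + 1)))
        ≤ (a / 4 * μ) * u i + (3 + 32 / a) * k₃ * μ ^ 3 := by
      have h1 : (3 + 16 / (a * μ / 2)) * μ ^ 4 ≤ (3 + 32 / a) * μ ^ 3 := by
        have : (3 + 16 / (a * μ / 2)) * μ ^ 4 = (3 * μ + 32 / a) * μ ^ 3 := by
          field_simp; ring
        rw [this]
        exact mul_le_mul_of_nonneg_right (by linarith) (by positivity)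
      have h2 := mul_le_mul_of_nonneg_right h1
        (show 0 ≤ k₃ * (K₁ ^ 4 * u i + 1) by have := hu0 i; positivity)
      have h3 : k₄ * μ ^ 3 ≤ a / 4 * μ := by
        have h4 : μ ^ 2 ≤ μ := by rw [sq]; exact mul_le_of_le_one_right hμ.le hμ1
        have h5 := mul_le_mul hkμ h4 (sq_nonneg μ) (by positivity)
        linarith
      have h4 := mul_le_mul_of_nonneg_right h3 (hu0 i)
      rw [hk₄def] at h4
      linarith
    have f1 := mul_le_mul_of_nonneg_left hUle (show 0 ≤ 1 + a * μ / 2 by positivity)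
    have f2 := mul_le_mul_of_nonneg_left hZle (show 0 ≤ 3 + 16 / (a * μ / 2) by positivity)
    rw [← heq] at hmain
    rw [hk₅def]
    linarith
  -- The fixed point is `k₅ μ³ / (a μ / 4)`; the slack `μ²` is the `+ 1` in the chosen constant.
  have hev := eventually_le_of_affine_recursion (t := a * μ / 4) (by positivity) (by linarith)
    (Filter.Eventually.of_forall hstep) (show 0 < μ ^ 2 by positivity)
  filter_upwards [hev] with i hi
  refine (hxu i).trans ?_
  rw [mul_assoc]
  refine mul_le_mul_of_nonneg_left (hi.trans (le_of_eq ?_)) (by positivity)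
  field_simp

/-- Second moment of a recursion `d' = Φ d + μ B y`, whose linear part contracts in the norm
`‖T ·‖` and whose input is of second order. -/
theorem exists_second_moment_bound (B : X →L[ℝ] X) (T : X →L[ℝ] F) {a K₁ K₂ K₃ : ℝ} (ha : 0 < a)
    (hT : ∀ x, ‖x‖ ≤ K₁ * ‖T x‖) (hK₂ : 0 ≤ K₂) :
    ∃ K μ₀ : ℝ, 0 ≤ K ∧ 0 < μ₀ ∧ ∀ μ, 0 < μ → μ ≤ μ₀ → ∀ Φ : X → X,
      (∀ x, ‖T (Φ x)‖ ^ 2 ≤ (1 - a * μ) * ‖T x‖ ^ 2) →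
      ∀ {Ω : Type*} [MeasurableSpace Ω] (P : Measure Ω) [IsProbabilityMeasure P]
        (x d y : ℕ → Ω → X), (∀ i, MemLp (x i) 4 P) → (∀ i, MemLp (d i) 2 P) →
        (∀ i ω, ‖y i ω‖ ≤ K₃ * ‖x i ω‖ ^ 2) →
        (∀ i ω, d (i + 1) ω = Φ (d i ω) + μ • B (y i ω)) →
        (∀ᶠ i in Filter.atTop, ∫ ω, ‖x i ω‖ ^ 4 ∂P ≤ K₂ * μ ^ 2) →
        ∀ᶠ i in Filter.atTop, ∫ ω, ‖d i ω‖ ^ 2 ∂P ≤ K * μ ^ 2 := by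
  set k₁ := ‖T‖ * ‖B‖ * K₃
  set k₂ := (1 + 2 / a) * k₁ ^ 2
  have hk₂ : 0 ≤ k₂ := by positivity
  refine ⟨K₁ ^ 2 * (k₂ * K₂ / (a / 2) + 1), min 1 (1 / a), by positivity,
    lt_min one_pos (by positivity), ?_⟩
  intro μ hμ hμ0 Φ hΦ Ω _ P _ x d y hx hd hy hrec hxev
  have hμ1 : μ ≤ 1 := hμ0.trans (min_le_left _ _)
  have haμ : a * μ ≤ 1 := by
    have := hμ0.trans (min_le_right _ _)
    rw [le_div_iff₀ ha] at this
    linarith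
  set v : ℕ → ℝ := fun i => ∫ ω, ‖T (d i ω)‖ ^ 2 ∂P with hv
  have hTd : ∀ i, Integrable (fun ω => ‖T (d i ω)‖ ^ 2) P := fun i =>
    (T.comp_memLp' (hd i)).integrable_norm_pow two_ne_zero
  have hd2 : ∀ i, Integrable (fun ω => ‖d i ω‖ ^ 2) P := fun i =>
    (hd i).integrable_norm_pow two_ne_zero
  have hdv : ∀ i, ∫ ω, ‖d i ω‖ ^ 2 ∂P ≤ K₁ ^ 2 * v i := by
    intro i
    rw [hv, ← integral_const_mul]
    refine integral_mono (hd2 i) ((hTd i).const_mul _) fun ω => ?_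
    change ‖d i ω‖ ^ 2 ≤ K₁ ^ 2 * ‖T (d i ω)‖ ^ 2
    rw [← mul_pow]
    exact pow_le_pow_left₀ (norm_nonneg _) (hT _) 2
  have hstep : ∀ i, v (i + 1)
      ≤ (1 - a / 2 * μ) * v i + μ * k₂ * ∫ ω, ‖x i ω‖ ^ 4 ∂P := by
    intro i
    have hpt : ∀ ω, ‖T (d (i + 1) ω)‖ ^ 2
        ≤ (1 - a / 2 * μ) * ‖T (d i ω)‖ ^ 2 + μ * k₂ * ‖x i ω‖ ^ 4 := by
      intro ω
      have h1 : ‖T (d (i + 1) ω)‖ ≤ ‖T (Φ (d i ω))‖ + μ * k₁ * ‖x i ω‖ ^ 2 := by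
        rw [hrec, map_add, map_smul]
        refine (norm_add_le _ _).trans (add_le_add_right ?_ _)
        rw [norm_smul, Real.norm_of_nonneg hμ.le, mul_assoc]
        refine mul_le_mul_of_nonneg_left ?_ hμ.le
        refine (T.le_opNorm_of_le (B.le_opNorm_of_le (hy i ω))).trans (le_of_eq ?_)
        ring
      -- The recursion for `d` contains no noise, so the bound is pathwise; the input `‖x‖²` enters
      -- as `μ ‖x‖⁴`.
      refine (pow_le_pow_left₀ (norm_nonneg _) h1 2).trans
        ((sq_slow_le ha hμ hμ1 (hΦ _)).trans (le_of_eq ?_))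
      ring
    have hi1 := (hTd i).const_mul (1 - a / 2 * μ)
    have hi2 := (hx i).integrable_pow_four.const_mul (μ * k₂)
    calc v (i + 1) ≤ ∫ ω, ((1 - a / 2 * μ) * ‖T (d i ω)‖ ^ 2 + μ * k₂ * ‖x i ω‖ ^ 4) ∂P :=
          integral_mono (hTd (i + 1)) (hi1.add hi2) hpt
      _ = _ := by rw [integral_add hi1 hi2, integral_const_mul, integral_const_mul]
  have hstep' : ∀ᶠ i in Filter.atTop, v (i + 1)
      ≤ (1 - a / 2 * μ) * v i + k₂ * K₂ * μ ^ 3 := by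
    filter_upwards [hxev] with i hi
    have := mul_le_mul_of_nonneg_left hi (show 0 ≤ μ * k₂ by positivity)
    linarith [hstep i]
  have hev := eventually_le_of_affine_recursion (t := a / 2 * μ) (by positivity) (by linarith)
    hstep' (show 0 < μ ^ 2 by positivity)
  filter_upwards [hev] with i hi
  refine (hdv i).trans ?_
  rw [mul_assoc]
  refine mul_le_mul_of_nonneg_left (hi.trans (le_of_eq ?_)) (by positivity)
  field_simp

end StochasticRecursion

/-! ### The Lyapunov function of a weakly-connected network -/

section Split

variable {X F₁ F₂ : Type*} [NormedAddCommGroup X] [NormedSpace ℝ X] [NormedAddCommGroup F₁]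
  [InnerProductSpace ℝ F₁] [NormedAddCommGroup F₂] [InnerProductSpace ℝ F₂]

lemma exists_continuousLinearMap_eq [FiniteDimensional ℝ X] (Y : X →ₗ[ℝ] F₂) :
    ∃ YL : X →L[ℝ] F₂, ∀ x, YL x = Y x :=
  ⟨LinearMap.toContinuousLinearMap Y, fun _ => rfl⟩

/-- The pair of two components in a Euclidean product. -/
def pairL (C : X →L[ℝ] F₁) (Y : X →L[ℝ] F₂) : X →L[ℝ] WithLp 2 (F₁ × F₂) :=
  ((WithLp.prodContinuousLinearEquiv 2 ℝ F₁ F₂).symm : (F₁ × F₂) →L[ℝ] WithLp 2 (F₁ × F₂)).comp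
    (C.prod Y)

lemma norm_pairL_sq (C : X →L[ℝ] F₁) (Y : X →L[ℝ] F₂) (x : X) :
    ‖pairL C Y x‖ ^ 2 = ‖C x‖ ^ 2 + ‖Y x‖ ^ 2 :=
  WithLp.prod_norm_sq_eq_of_L2 (pairL C Y x)

lemma norm_le_norm_pairL (C : X →L[ℝ] F₁) (Y : X →L[ℝ] F₂) (ι : F₁ →L[ℝ] X) {K : ℝ} (hK : 0 ≤ K)
    (hι : ∀ x, ‖x - ι (C x)‖ ≤ K * ‖Y x‖) (x : X) : ‖x‖ ≤ (‖ι‖ + K) * ‖pairL C Y x‖ := by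
  have hC : ‖C x‖ ≤ ‖pairL C Y x‖ :=
    (pow_le_pow_iff_left₀ (norm_nonneg _) (norm_nonneg _) two_ne_zero).mp
      (by rw [norm_pairL_sq]; exact le_add_of_nonneg_right (sq_nonneg _))
  have hY : ‖Y x‖ ≤ ‖pairL C Y x‖ :=
    (pow_le_pow_iff_left₀ (norm_nonneg _) (norm_nonneg _) two_ne_zero).mp
      (by rw [norm_pairL_sq]; exact le_add_of_nonneg_left (sq_nonneg _))
  calc ‖x‖ = ‖ι (C x) + (x - ι (C x))‖ := by rw [add_sub_cancel]
    _ ≤ _ := norm_add_le _ _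
    _ ≤ ‖ι‖ * ‖pairL C Y x‖ + K * ‖pairL C Y x‖ :=
      add_le_add (ι.le_opNorm_of_le hC) ((hι x).trans (mul_le_mul_of_nonneg_left hY hK))
    _ = _ := by ring

end Split

section Lyapunov

variable {VS VR : Type*} [Fintype VS] [Fintype VR] {S R M : ℕ}
  {A : Matrix (VS ⊕ VR) (VS ⊕ VR) ℝ} {subS : VS → Fin S} {subR : VR → Fin R} {p : VS → ℝ}

/-- The Euclidean space of centroids and weighted deviations. -/
abbrev LyapSpace (S N : ℕ) (V : Type*) [Fintype V] (M : ℕ) : Type _ :=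
  WithLp 2 (PiLp 2 (fun _ : Fin S => Vec M) × PiLp 2 (fun _ : Fin N × V => Vec M))

/-- The combination step as a continuous linear map. -/
def combineL {V : Type*} [Fintype V] (A : Matrix V V ℝ) (M : ℕ) :
    (V → Vec M) →L[ℝ] (V → Vec M) :=
  LinearMap.toContinuousLinearMap (combineMap A M)

lemma combineL_apply {V : Type*} [Fintype V] (A : Matrix V V ℝ) (x : V → Vec M) (k : V) :
    combineL A M x k = ∑ ℓ, A ℓ k • x ℓ := rfl

/-- The centroids as an element of a Euclidean space. -/
def centroidL (subS : VS → Fin S) (p : VS → ℝ) (M : ℕ) :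
    (VS ⊕ VR → Vec M) →L[ℝ] PiLp 2 (fun _ : Fin S => Vec M) :=
  ((PiLp.continuousLinearEquiv 2 ℝ (fun _ : Fin S => Vec M)).symm :
    (Fin S → Vec M) →L[ℝ] PiLp 2 (fun _ : Fin S => Vec M)).comp
    (LinearMap.toContinuousLinearMap (centroid subS p M))

lemma centroidL_apply (x : VS ⊕ VR → Vec M) (s : Fin S) :
    (centroidL subS p M x : PiLp 2 (fun _ : Fin S => Vec M)) s = centroid subS p M x s := rfl

lemma centroidL_eq_iff (x y : VS ⊕ VR → Vec M) :
    centroidL subS p M x = centroidL subS p M y ↔ centroid subS p M x = centroid subS p M y :=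
  (PiLp.continuousLinearEquiv 2 ℝ (fun _ : Fin S => Vec M)).symm.injective.eq_iff

variable [DecidableEq VR]

/-- The limit points as a function of the Euclidean vector of centroids. -/
def limitL (A : Matrix (VS ⊕ VR) (VS ⊕ VR) ℝ) (subS : VS → Fin S) (M : ℕ) :
    PiLp 2 (fun _ : Fin S => Vec M) →L[ℝ] (VS ⊕ VR → Vec M) :=
  (LinearMap.toContinuousLinearMap (limitMap A subS M)).comp
    (PiLp.continuousLinearEquiv 2 ℝ (fun _ : Fin S => Vec M) :
      PiLp 2 (fun _ : Fin S => Vec M) →L[ℝ] (Fin S → Vec M))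

lemma limitL_apply_inl (c : PiLp 2 (fun _ : Fin S => Vec M)) (k : VS) :
    limitL A subS M c (Sum.inl k) = c (subS k) := rfl

lemma limitL_centroidL (x : VS ⊕ VR → Vec M) :
    limitL A subS M (centroidL subS p M x) = limitMap A subS M (centroid subS p M x) := rfl

/-- The average of a field that is monotone at every agent, and strongly so at one agent of every
sending sub-network, is strongly monotone in the centroids. -/
lemma IsWeaklyConnectedNetwork.exists_strongly_monotone
    (hA : IsWeaklyConnectedNetwork A subS subR) (hp : IsPerronFamily A subS p)
    {f : (VS ⊕ VR → Vec M) → (VS ⊕ VR → Vec M)} {ν : VS → ℝ}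
    (hf0 : centroidL subS p M (f 0) = 0) (hν0 : ∀ k, 0 ≤ ν k)
    (hν : ∀ s, ∃ k, subS k = s ∧ 0 < ν k)
    (hmono : ∀ k x, ν k * ‖x (Sum.inl k)‖ ^ 2
      ≤ ⟪x (Sum.inl k), f x (Sum.inl k) - f 0 (Sum.inl k)⟫_ℝ) :
    ∃ ν₁ : ℝ, 0 < ν₁ ∧ ∀ c, ν₁ * ‖c‖ ^ 2 ≤ ⟪c, centroidL subS p M (f (limitL A subS M c))⟫_ℝ := by
  classical
  -- On limit vectors all agents of sub-network `s` carry the same value `c s`, so their moduli add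
  -- up with the positive Perron weights, and one positive modulus suffices.
  have hpν : ∀ s, 0 < ∑ k with subS k = s, p k * ν k := by
    intro s
    obtain ⟨k, hk, hνk⟩ := hν s
    exact (mul_pos (hp.pos hA k) hνk).trans_le (Finset.single_le_sum
      (f := fun k => p k * ν k) (fun k _ => mul_nonneg (hp.pos hA k).le (hν0 k)) (by simp [hk]))
  obtain ⟨ν₁, hν₁, hν₁0⟩ : ∃ ν₁ : ℝ, (∀ s, ν₁ ≤ ∑ k with subS k = s, p k * ν k) ∧ 0 < ν₁ := by
    have h1 : ∀ᶠ ν₁ : ℝ in nhdsWithin 0 (Set.Ioi 0),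
        ∀ s, ν₁ ≤ ∑ k with subS k = s, p k * ν k := by
      simp only [Filter.eventually_all]
      exact fun s => (eventually_le_nhds (hpν s)).filter_mono nhdsWithin_le_nhds
    exact (h1.and self_mem_nhdsWithin).exists
  refine ⟨ν₁, hν₁0, fun c => ?_⟩
  have h0 : centroidL subS p M (f (limitL A subS M c))
      = centroidL subS p M (f (limitL A subS M c) - f 0) := by
    rw [map_sub, hf0, sub_zero]
  rw [h0, PiLp.norm_sq_eq_of_L2, PiLp.inner_apply, Finset.mul_sum]
  refine Finset.sum_le_sum fun s _ => ?_
  rw [centroidL_apply, centroid_apply, inner_sum]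
  refine (mul_le_mul_of_nonneg_right (hν₁ s) (sq_nonneg _)).trans ?_
  rw [Finset.sum_mul]
  refine Finset.sum_le_sum fun k hk => ?_
  have h2 := hmono k (limitL A subS M c)
  rw [limitL_apply_inl, (Finset.mem_filter.mp hk).2] at h2
  rw [inner_smul_right, mul_assoc, Pi.sub_apply]
  exact mul_le_mul_of_nonneg_left h2 (hp.pos hA k).le

/-- A Euclidean norm `‖T ·‖` on network vectors in which every step `x ↦ 𝒜ᵀ (x - μ f x)` with a
monotone field `f` contracts at a rate proportional to `μ`. -/
theorem IsWeaklyConnectedNetwork.exists_lyapunov (hA : IsWeaklyConnectedNetwork A subS subR)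
    (hp : IsPerronFamily A subS p) (M : ℕ) :
    ∃ (N : ℕ) (T : (VS ⊕ VR → Vec M) →L[ℝ] LyapSpace S N (VS ⊕ VR) M) (K₁ : ℝ),
      (∀ x, ‖x‖ ≤ K₁ * ‖T x‖) ∧
      ∀ (f : (VS ⊕ VR → Vec M) → (VS ⊕ VR → Vec M)) (L : ℝ) (ν : VS → ℝ), 0 ≤ L →
        (∀ x y, ‖f x - f y‖ ≤ L * ‖x - y‖) → centroid subS p M (f 0) = 0 →
        (∀ k, 0 ≤ ν k) → (∀ s, ∃ k, subS k = s ∧ 0 < ν k) →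
        (∀ k x, ν k * ‖x (Sum.inl k)‖ ^ 2
          ≤ ⟪x (Sum.inl k), f x (Sum.inl k) - f 0 (Sum.inl k)⟫_ℝ) →
        ∃ a K μ₀ : ℝ, 0 < a ∧ 0 ≤ K ∧ 0 < μ₀ ∧ ∀ μ, 0 < μ → μ ≤ μ₀ → ∀ x,
          ‖T (combineL A M (x - μ • f x))‖ ^ 2
            ≤ (1 - a * μ) * ‖T x‖ ^ 2 + K * ‖f 0‖ ^ 2 * μ ^ 2 := by
  obtain ⟨N, r, K, Y, hr0, hr1, hK, hY, hdev⟩ := hA.exists_deviation hp M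
  obtain ⟨YL, hYL⟩ : ∃ YL : (VS ⊕ VR → Vec M) →L[ℝ]
      PiLp 2 (fun _ : Fin N × (VS ⊕ VR) => Vec M), ∀ x, YL x = Y x :=
    exists_continuousLinearMap_eq Y
  have hι : ∀ x, ‖x - limitL A subS M (centroidL subS p M x)‖ ≤ K * ‖YL x‖ := fun x => by
    rw [limitL_centroidL, hYL]
    exact hdev x
  have hCB : ∀ x, centroidL subS p M (combineL A M x) = centroidL subS p M x := fun x =>
    (centroidL_eq_iff _ _).mpr (hA.centroid_combineMap hp x)
  have hYB : ∀ x, ‖YL (combineL A M x)‖ ≤ r * ‖YL x‖ := fun x => by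
    rw [hYL, hYL]
    exact hY x
  refine ⟨N, pairL (centroidL subS p M) YL, ‖limitL A subS M‖ + K,
    norm_le_norm_pairL _ _ _ hK hι, fun f L ν hL0 hL hf0 hν0 hν hmono => ?_⟩
  have hCf0 : centroidL subS p M (f 0) = 0 := by
    rw [← map_zero (centroidL (VR := VR) subS p M), centroidL_eq_iff, hf0, map_zero]
  obtain ⟨ν₁, hν₁, hstrong⟩ := hA.exists_strongly_monotone hp hCf0 hν0 hν hmono
  obtain ⟨a, K', μ₀, ha, hK', hμ₀, h⟩ := exists_drift (combineL A M) (centroidL subS p M)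
    YL (limitL A subS M) hr0 hr1 hK hCB hYB hι hL0 hL hCf0 hν₁ hstrong
  refine ⟨a, K', μ₀, ha, hK', hμ₀, fun μ hμ hμ0 x => ?_⟩
  rw [norm_pairL_sq, norm_pairL_sq]
  exact h μ hμ hμ0 x

end Lyapunov

/-! ### The fields of the two error recursions -/

section Fields

variable {V : Type*} {M : ℕ}

/-- The field of the true error recursion: the negative scaled gradients as functions of the
error. -/
def costField (J : V → Vec M → ℝ) (wstar : V → Vec M) (τ : V → ℝ) (x : V → Vec M) : V → Vec M :=
  fun k => -(τ k • gradient (J k) (wstar k - x k))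

/-- The linear part of the field of the long-term model. -/
def hessField (J : V → Vec M → ℝ) (wstar : V → Vec M) (τ : V → ℝ) (x : V → Vec M) : V → Vec M :=
  fun k => τ k • hessian (J k) (wstar k) (x k)

variable {J : V → Vec M → ℝ} {wstar : V → Vec M} {τ : V → ℝ} {δ : ℝ}

lemma hessField_sub (x y : V → Vec M) :
    hessField J wstar τ (x - y) = hessField J wstar τ x - hessField J wstar τ y := by
  ext1 k
  simp [hessField, smul_sub]

lemma hessField_zero : hessField J wstar τ 0 = 0 := by
  ext1 k
  simp [hessField]

variable [Fintype V]

lemma norm_costField_sub_le (hτ : ∀ k, 0 < τ k ∧ τ k ≤ 1)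
    (hd2 : ∀ k, Differentiable ℝ (gradient (J k))) (hδ0 : 0 ≤ δ)
    (hδ : ∀ k x, ‖hessian (J k) x‖ ≤ δ) (x y : V → Vec M) :
    ‖costField J wstar τ x - costField J wstar τ y‖ ≤ δ * ‖x - y‖ := by
  refine (pi_norm_le_iff_of_nonneg (by positivity)).mpr fun k => ?_
  have h1 : (costField J wstar τ x - costField J wstar τ y) k
      = τ k • (gradient (J k) (wstar k - y k) - gradient (J k) (wstar k - x k)) := by
    simp only [costField, Pi.sub_apply]
    module
  rw [h1, norm_smul, Real.norm_of_nonneg (hτ k).1.le]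
  refine (mul_le_of_le_one_left (norm_nonneg _) (hτ k).2).trans
    ((norm_gradient_sub_le (hd2 k) (hδ k) _ _).trans ?_)
  rw [sub_sub_sub_cancel_left]
  exact mul_le_mul_of_nonneg_left (norm_le_pi_norm (x - y) k) hδ0

lemma norm_hessField_sub_le (hτ : ∀ k, 0 < τ k ∧ τ k ≤ 1) (hδ0 : 0 ≤ δ)
    (hδ : ∀ k x, ‖hessian (J k) x‖ ≤ δ) (x y : V → Vec M) :
    ‖hessField J wstar τ x - hessField J wstar τ y‖ ≤ δ * ‖x - y‖ := by
  rw [← hessField_sub]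
  refine (pi_norm_le_iff_of_nonneg (by positivity)).mpr fun k => ?_
  rw [hessField, norm_smul, Real.norm_of_nonneg (hτ k).1.le]
  refine (mul_le_of_le_one_left (norm_nonneg _) (hτ k).2).trans ?_
  exact (ContinuousLinearMap.le_of_opNorm_le _ (hδ k _) _).trans
    (mul_le_mul_of_nonneg_left (norm_le_pi_norm (x - y) k) hδ0)

/-- The difference of the two fields is of second order in the error. -/
lemma norm_hessField_sub_costField_le (hτ : ∀ k, 0 < τ k ∧ τ k ≤ 1)
    (hd2 : ∀ k, Differentiable ℝ (gradient (J k))) (hδ0 : 0 ≤ δ)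
    (hδ : ∀ k x, ‖hessian (J k) x‖ ≤ δ) {κ ε : ℝ} (hκ : 0 ≤ κ) (hε : 0 < ε)
    (hsmooth : HessianSmoothAt J wstar κ ε) (x : V → Vec M) :
    ‖hessField J wstar τ x - (costField J wstar τ x - costField J wstar τ 0)‖
      ≤ (κ + 2 * δ / ε) * ‖x‖ ^ 2 := by
  have hc : 0 ≤ κ + 2 * δ / ε := by positivity
  refine (pi_norm_le_iff_of_nonneg (by positivity)).mpr fun k => ?_
  have h1 : (hessField J wstar τ x - (costField J wstar τ x - costField J wstar τ 0)) k
      = τ k • (hessian (J k) (wstar k) (x k) - avgHessian J wstar k (x k) (x k)) := by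
    rw [avgHessian_apply (hd2 k) (hδ k)]
    simp only [hessField, costField, Pi.sub_apply, Pi.zero_apply, sub_zero]
    module
  rw [h1, norm_smul, Real.norm_of_nonneg (hτ k).1.le]
  refine (mul_le_of_le_one_left (norm_nonneg _) (hτ k).2).trans
    ((norm_hessian_sub_avgHessian_le hκ hε hsmooth (hδ k) (x k)).trans ?_)
  exact mul_le_mul_of_nonneg_left
    (pow_le_pow_left₀ (norm_nonneg _) (norm_le_pi_norm x k) 2) hc

lemma continuous_of_norm_sub_le {E F : Type*} [NormedAddCommGroup E] [NormedAddCommGroup F]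
    {f : E → F} {L : ℝ} (hL0 : 0 ≤ L) (hL : ∀ x y, ‖f x - f y‖ ≤ L * ‖x - y‖) : Continuous f :=
  (LipschitzWith.of_dist_le_mul (K := L.toNNReal) fun x y => by
    rw [dist_eq_norm, dist_eq_norm, Real.coe_toNNReal L hL0]; exact hL x y).continuous

lemma memLp_comp_of_norm_sub_le {E F : Type*} [NormedAddCommGroup E] [NormedAddCommGroup F]
    {f : E → F} {L : ℝ} (hL0 : 0 ≤ L) (hL : ∀ x y, ‖f x - f y‖ ≤ L * ‖x - y‖) {Ω : Type*}
    [MeasurableSpace Ω] {P : Measure Ω} [IsFiniteMeasure P] {q : ENNReal} {x : Ω → E}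
    (hx : MemLp x q P) : MemLp (fun ω => f (x ω)) q P := by
  refine ((hx.norm.const_mul L).add (memLp_const ‖f 0‖)).mono
    ((continuous_of_norm_sub_le hL0 hL).comp_aestronglyMeasurable hx.aestronglyMeasurable)
    (Filter.Eventually.of_forall fun ω => ?_)
  have h1 := hL (x ω) 0
  rw [sub_zero] at h1
  have h2 := norm_add_le (f (x ω) - f 0) (f 0)
  rw [sub_add_cancel] at h2
  rw [Pi.add_apply, Real.norm_of_nonneg (by positivity)]
  linarith

end Fields

/-! ### Monotonicity of the two fields -/

section CostConditions

variable {VS VR : Type*} {S M : ℕ} {subS : VS → Fin S} {J : VS ⊕ VR → Vec M → ℝ}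
  {wstar : VS ⊕ VR → Vec M} {τ : VS ⊕ VR → ℝ}

/-- Agents whose cost is merely convex receive the modulus `0`, which lets one inequality cover all
sending agents. -/
lemma CostConditions.exists_modulus (hJ : CostConditions subS J) :
    ∃ ν : VS → ℝ, (∀ k, 0 ≤ ν k) ∧ (∀ k, StrongConvexOn Set.univ (ν k) (J (Sum.inl k))) ∧
      ∀ s, ∃ k, subS k = s ∧ 0 < ν k := by
  have h : ∀ k : VS, ∃ ν : ℝ, 0 ≤ ν ∧ StrongConvexOn Set.univ ν (J (Sum.inl k)) ∧
      ((∃ ν' : ℝ, 0 < ν' ∧ StrongConvexOn Set.univ ν' (J (Sum.inl k))) → 0 < ν) := by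
    intro k
    by_cases hk : ∃ ν' : ℝ, 0 < ν' ∧ StrongConvexOn Set.univ ν' (J (Sum.inl k))
    · obtain ⟨ν, hν, hs⟩ := hk
      exact ⟨ν, hν.le, hs, fun _ => hν⟩
    · exact ⟨0, le_rfl, strongConvexOn_zero.mpr (hJ.convex _), fun h => absurd h hk⟩
  choose ν h0 h1 h2 using h
  refine ⟨ν, h0, h1, fun s => ?_⟩
  obtain ⟨k, hk, hs⟩ := hJ.strongly_convex s
  exact ⟨k, hk, h2 k hs⟩

lemma le_inner_costField {ν : ℝ} {k : VS ⊕ VR} (hτ : 0 < τ k)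
    (hs : StrongConvexOn Set.univ ν (J k)) (hd : Differentiable ℝ (J k))
    (x : VS ⊕ VR → Vec M) :
    τ k * ν * ‖x k‖ ^ 2
      ≤ ⟪x k, costField J wstar τ x k - costField J wstar τ 0 k⟫_ℝ := by
  have h1 : costField J wstar τ x k - costField J wstar τ 0 k
      = τ k • (gradient (J k) (wstar k) - gradient (J k) (wstar k - x k)) := by
    simp only [costField, Pi.zero_apply, sub_zero]
    module
  have h2 := hs.le_inner_gradient_sub hd (wstar k) (wstar k - x k)
  rw [sub_sub_cancel, real_inner_comm] at h2
  rw [h1, inner_smul_right, mul_assoc]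
  exact mul_le_mul_of_nonneg_left h2 hτ.le

lemma le_inner_hessField {ν : ℝ} {k : VS ⊕ VR} (hτ : 0 < τ k)
    (hs : StrongConvexOn Set.univ ν (J k)) (hd : Differentiable ℝ (J k))
    (hd2 : Differentiable ℝ (gradient (J k))) (x : VS ⊕ VR → Vec M) :
    τ k * ν * ‖x k‖ ^ 2
      ≤ ⟪x k, hessField J wstar τ x k - hessField J wstar τ 0 k⟫_ℝ := by
  have h2 := hs.le_inner_hessian hd hd2 (wstar k) (x k)
  rw [hessField_zero, Pi.zero_apply, sub_zero, hessField, inner_smul_right, mul_assoc]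
  exact mul_le_mul_of_nonneg_left h2 hτ.le

end CostConditions

/-! ### The error processes -/

section ErrorRecursion

variable {V Ω : Type*} {M : ℕ} {A : Matrix V V ℝ} {J : V → Vec M → ℝ}
  {wstar : V → Vec M} {τ : V → ℝ} {μ : ℝ} {w g e' : V → ℕ → Ω → Vec M}

lemma pastSigma_le [MeasurableSpace Ω] (hw : ∀ k i, Measurable (w k i)) (i : ℕ) :
    pastSigma w i ≤ ‹MeasurableSpace Ω› :=
  iSup_le fun ℓ => iSup_le fun j => iSup_le fun _ => (hw ℓ j).comap_le

variable [Fintype V]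

lemma stronglyMeasurable_errorVec (i : ℕ) :
    StronglyMeasurable[pastSigma w i] fun ω => (fun k => errorVec wstar w k i ω) := by
  have h : ∀ k, Measurable[pastSigma w i] (w k i) := fun k =>
    Measurable.mono (comap_measurable (w k i))
      (le_iSup_of_le k (le_iSup_of_le i (le_iSup_of_le le_rfl le_rfl))) le_rfl
  have h2 : Measurable[pastSigma w i] fun ω => (fun k => errorVec wstar w k i ω) :=
    @measurable_pi_lambda _ _ _ (pastSigma w i) _ _ fun k => (h k).const_sub (wstar k)
  exact h2.stronglyMeasurable

/-- The scaled gradient noise as a network vector. -/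
def scaledNoise (J : V → Vec M → ℝ) (τ : V → ℝ) (w g : V → ℕ → Ω → Vec M) (i : ℕ) (ω : Ω) :
    V → Vec M :=
  fun k => τ k • gradNoise J w g k i ω

/-- Subtract the combination step from the identity `𝒜ᵀ w^⋆ = w^⋆`. -/
lemma errorVec_succ
    (hw : ∀ k i ω, w k (i + 1) ω = ∑ ℓ, A ℓ k • adapt (fun k => τ k * μ) w g ℓ i ω)
    (hfix : combineL A M wstar = wstar) (i : ℕ) (ω : Ω) :
    (fun k => errorVec wstar w k (i + 1) ω)
      = combineL A M ((fun k => errorVec wstar w k i ω)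
          - μ • costField J wstar τ (fun k => errorVec wstar w k i ω))
        + μ • combineL A M (scaledNoise J τ w g i ω) := by
  ext1 k
  rw [← map_smul, ← map_add, combineL_apply, errorVec, hw, ← hfix, combineL_apply,
    ← Finset.sum_sub_distrib, hfix]
  refine Finset.sum_congr rfl fun ℓ _ => ?_
  rw [← smul_sub]
  congr 1
  simp only [adapt, errorVec, costField, scaledNoise, gradNoise, Pi.add_apply, Pi.sub_apply,
    Pi.smul_apply, sub_sub_cancel]
  module

lemma isNonlinearErrorModel
    (hw : ∀ k i ω, w k (i + 1) ω = ∑ ℓ, A ℓ k • adapt (fun k => τ k * μ) w g ℓ i ω)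
    (hfix : combineL A M wstar = wstar) (hd2 : ∀ k, Differentiable ℝ (gradient (J k))) {δ : ℝ}
    (hδ : ∀ k x, ‖hessian (J k) x‖ ≤ δ) :
    IsNonlinearErrorModel A J wstar (fun k => τ k * μ) (gradNoise J w g) (errorVec wstar w) := by
  intro k i ω
  rw [errorVec, hw, ← hfix, combineL_apply, ← Finset.sum_sub_distrib, hfix, errorStep,
    ← Finset.sum_sub_distrib, ← Finset.sum_add_distrib]
  refine Finset.sum_congr rfl fun ℓ _ => ?_
  rw [← smul_sub, ← smul_sub, ← smul_add, avgHessian_apply (hd2 ℓ) (hδ ℓ)]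
  congr 1
  simp only [adapt, errorVec, gradNoise, sub_sub_cancel]
  module

lemma IsLongTermModel.succ_eq
    (h : IsLongTermModel A J wstar (fun k => τ k * μ) (gradNoise J w g) e') (i : ℕ) (ω : Ω) :
    (fun k => e' k (i + 1) ω)
      = combineL A M ((fun k => e' k i ω) - μ • hessField J wstar τ (fun k => e' k i ω)
          - μ • costField J wstar τ 0)
        + μ • combineL A M (scaledNoise J τ w g i ω) := by
  ext1 k
  rw [← map_smul, ← map_add, combineL_apply, h k i ω, errorStep, ← Finset.sum_sub_distrib,
    ← Finset.sum_add_distrib]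
  refine Finset.sum_congr rfl fun ℓ _ => ?_
  rw [← smul_sub, ← smul_add]
  congr 1
  simp only [hessField, costField, scaledNoise, Pi.add_apply, Pi.sub_apply,
    Pi.smul_apply, Pi.zero_apply, sub_zero]
  module

variable [MeasurableSpace Ω] {P : Measure Ω} {β σ : V → ℝ}

lemma NoiseConditions.memLp_scaledNoise (hn : NoiseConditions P J w g β σ) (i : ℕ) :
    MemLp (scaledNoise J τ w g i) 4 P :=
  memLp_pi_iff.mpr fun k => (hn.memLp k i).const_smul (τ k)

lemma NoiseConditions.condExp_scaledNoise [IsProbabilityMeasure P]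
    (hn : NoiseConditions P J w g β σ) (i : ℕ) :
    P[scaledNoise J τ w g i | pastSigma w i] =ᵐ[P] 0 := by
  have hint : Integrable (scaledNoise J τ w g i) P :=
    (hn.memLp_scaledNoise i).integrable (by norm_num)
  have h : ∀ k, ∀ᵐ ω ∂P, P[scaledNoise J τ w g i | pastSigma w i] ω k = 0 := by
    intro k
    have h1 := ContinuousLinearMap.comp_condExp_comm (m := pastSigma w i) hint
      (ContinuousLinearMap.proj (R := ℝ) (φ := fun _ : V => Vec M) k)
    have h2 := condExp_smul (μ := P) (τ k) (gradNoise J w g k i) (pastSigma w i)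
    filter_upwards [h1, h2, hn.zero_mean k i] with ω e1 e2 e3
    refine e1.trans (e2.trans ?_)
    rw [Pi.smul_apply, e3, Pi.zero_apply, smul_zero]
  filter_upwards [ae_all_iff.mpr h] with ω hω
  ext1 k
  exact hω k

lemma NoiseConditions.integral_scaledNoise_le [IsProbabilityMeasure P]
    (hn : NoiseConditions P J w g β σ) (hτ : ∀ k, 0 < τ k ∧ τ k ≤ 1)
    (hw : ∀ k i, Measurable (w k i)) (i : ℕ)
    (hx : MemLp (fun ω => (fun k => errorVec wstar w k i ω)) 4 P) :
    ∫ ω, ‖scaledNoise J τ w g i ω‖ ^ 4 ∂P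
      ≤ (∑ k, (8 * β k ^ 4 + 8 * β k ^ 4 * ‖wstar k‖ ^ 4 + σ k ^ 4))
        * (∫ ω, ‖(fun k => errorVec wstar w k i ω : V → Vec M)‖ ^ 4 ∂P + 1) := by
  set I := ∫ ω, ‖(fun k => errorVec wstar w k i ω : V → Vec M)‖ ^ 4 ∂P
  have hI : 0 ≤ I := integral_nonneg fun ω => by positivity
  have hx4 := hx.integrable_pow_four
  have hs4 : ∀ k, Integrable (fun ω => ‖gradNoise J w g k i ω‖ ^ 4) P := fun k =>
    (hn.memLp k i).integrable_pow_four
  have hk : ∀ k, ∫ ω, ‖gradNoise J w g k i ω‖ ^ 4 ∂P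
      ≤ 8 * β k ^ 4 * I + (8 * β k ^ 4 * ‖wstar k‖ ^ 4 + σ k ^ 4) := by
    intro k
    rw [← integral_condExp (pastSigma_le hw i)]
    have hi := hx4.const_mul (8 * β k ^ 4)
    calc ∫ ω, (P[fun ω => ‖gradNoise J w g k i ω‖ ^ 4 | pastSigma w i]) ω ∂P
        ≤ ∫ ω, (8 * β k ^ 4 * ‖(fun k => errorVec wstar w k i ω : V → Vec M)‖ ^ 4
            + (8 * β k ^ 4 * ‖wstar k‖ ^ 4 + σ k ^ 4)) ∂P := by
          refine integral_mono_ae integrable_condExp (hi.add (integrable_const _)) ?_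
          filter_upwards [hn.fourth_moment k i] with ω hω
          refine hω.trans ?_
          set X := ‖(fun k => errorVec wstar w k i ω : V → Vec M)‖
          have h1 : ‖w k i ω‖ ≤ ‖wstar k‖ + X := by
            have h2 : w k i ω = wstar k - errorVec wstar w k i ω := by
              rw [errorVec, sub_sub_cancel]
            rw [h2]
            exact (norm_sub_le _ _).trans (add_le_add_right
              (norm_le_pi_norm (fun k => errorVec wstar w k i ω : V → Vec M) k) _)
          -- Power mean inequality, with `8 = 2 ^ 3`.
          have h2 : ‖w k i ω‖ ^ 4 ≤ 8 * (‖wstar k‖ ^ 4 + X ^ 4) := by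
            refine (pow_le_pow_left₀ (norm_nonneg _) h1 4).trans ?_
            exact (add_pow_le (norm_nonneg _) (norm_nonneg _) 4).trans (by norm_num [X])
          have h3 := mul_le_mul_of_nonneg_left h2 (show 0 ≤ β k ^ 4 by positivity)
          linarith
      _ = _ := by
          rw [integral_add hi (integrable_const _), integral_const_mul]
          simp [I]
  have hpt : ∀ ω, ‖scaledNoise J τ w g i ω‖ ^ 4 ≤ ∑ k, ‖gradNoise J w g k i ω‖ ^ 4 := by
    intro ω
    rcases isEmpty_or_nonempty V with hV | hV
    · simp [Subsingleton.elim (scaledNoise J τ w g i ω) 0]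
    · obtain ⟨k, hk⟩ := Finite.exists_max fun k => ‖scaledNoise J τ w g i ω k‖
      have h1 : ‖scaledNoise J τ w g i ω‖ ≤ ‖gradNoise J w g k i ω‖ := by
        refine (pi_norm_le_iff_of_nonneg (norm_nonneg _)).mpr fun ℓ => (hk ℓ).trans ?_
        rw [scaledNoise, norm_smul, Real.norm_of_nonneg (hτ k).1.le]
        exact mul_le_of_le_one_left (norm_nonneg _) (hτ k).2
      exact (pow_le_pow_left₀ (norm_nonneg _) h1 4).trans (Finset.single_le_sum
        (f := fun k => ‖gradNoise J w g k i ω‖ ^ 4) (fun _ _ => by positivity) (Finset.mem_univ k))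
  calc ∫ ω, ‖scaledNoise J τ w g i ω‖ ^ 4 ∂P
      ≤ ∫ ω, ∑ k, ‖gradNoise J w g k i ω‖ ^ 4 ∂P :=
        integral_mono (hn.memLp_scaledNoise i).integrable_pow_four
          (integrable_finsetSum _ fun k _ => hs4 k) hpt
    _ = ∑ k, ∫ ω, ‖gradNoise J w g k i ω‖ ^ 4 ∂P := integral_finsetSum _ fun k _ => hs4 k
    _ ≤ ∑ k, (8 * β k ^ 4 + 8 * β k ^ 4 * ‖wstar k‖ ^ 4 + σ k ^ 4) * (I + 1) := by
        refine Finset.sum_le_sum fun k _ => (hk k).trans ?_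
        have h1 : 0 ≤ (8 * β k ^ 4 * ‖wstar k‖ ^ 4 + σ k ^ 4) * I := by positivity
        have h2 : 0 ≤ β k ^ 4 := by positivity
        linarith
    _ = _ := by rw [Finset.sum_mul]

end ErrorRecursion

/-! ### Limits superior of mean squares -/

section Limsup

variable {V Ω : Type*} [Fintype V] {M : ℕ} [MeasurableSpace Ω] {P : Measure Ω}

lemma limsupMeanSq_eq {x : V → ℕ → Ω → Vec M} (hx : ∀ k i, MemLp (x k i) 2 P) :
    limsupMeanSq P x
      = Filter.limsup (fun i => ENNReal.ofReal (∫ ω, ∑ k, ‖x k i ω‖ ^ 2 ∂P)) Filter.atTop := by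
  rw [limsupMeanSq]
  congr 1
  ext1 i
  rw [ofReal_integral_eq_lintegral_ofReal
    (integrable_finsetSum _ fun k _ => (hx k i).integrable_norm_pow two_ne_zero)
    (Filter.Eventually.of_forall fun ω => Finset.sum_nonneg fun k _ => sq_nonneg _)]
  refine lintegral_congr fun ω => ?_
  rw [ENNReal.ofReal_sum_of_nonneg fun k _ => sq_nonneg _]
  refine Finset.sum_congr rfl fun k _ => ?_
  rw [ENNReal.ofReal_pow (norm_nonneg _), ofReal_norm]

/-- Limits superior are monotone and commute with adding a constant. The argument runs in `[0, ∞]`,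
where finiteness has to be shown before passing to real values. -/
lemma toReal_limsup_sub_le {a b : ℕ → ℝ} {B c : ℝ} (hc : 0 ≤ c)
    (ha : ∀ᶠ i in Filter.atTop, a i ≤ B) (hab : ∀ᶠ i in Filter.atTop, |a i - b i| ≤ c) :
    Filter.limsup (fun i => ENNReal.ofReal (a i)) Filter.atTop < ⊤ ∧
      Filter.limsup (fun i => ENNReal.ofReal (b i)) Filter.atTop < ⊤ ∧
      |(Filter.limsup (fun i => ENNReal.ofReal (a i)) Filter.atTop).toReal
        - (Filter.limsup (fun i => ENNReal.ofReal (b i)) Filter.atTop).toReal| ≤ c := by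
  have hle : ∀ {a b : ℕ → ℝ}, (∀ᶠ i in Filter.atTop, a i ≤ b i + c) →
      Filter.limsup (fun i => ENNReal.ofReal (a i)) Filter.atTop
        ≤ Filter.limsup (fun i => ENNReal.ofReal (b i)) Filter.atTop + ENNReal.ofReal c := by
    intro a b h
    rw [← limsup_add_const _ _ _ (by isBoundedDefault) (by isBoundedDefault)]
    refine Filter.limsup_le_limsup ?_
    filter_upwards [h] with i hi
    exact (ENNReal.ofReal_le_ofReal hi).trans ENNReal.ofReal_add_le
  have h1 := hle (a := a) (b := b) (hab.mono fun i hi => by have := (abs_le.mp hi).2; linarith)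
  have h2 := hle (a := b) (b := a) (hab.mono fun i hi => by have := (abs_le.mp hi).1; linarith)
  have hfa : Filter.limsup (fun i => ENNReal.ofReal (a i)) Filter.atTop < ⊤ :=
    (Filter.limsup_le_of_le (h := ha.mono fun i hi => ENNReal.ofReal_le_ofReal hi)).trans_lt
      ENNReal.ofReal_lt_top
  have hfb : Filter.limsup (fun i => ENNReal.ofReal (b i)) Filter.atTop < ⊤ :=
    h2.trans_lt (ENNReal.add_lt_top.mpr ⟨hfa, ENNReal.ofReal_lt_top⟩)
  refine ⟨hfa, hfb, abs_le.mpr ?_⟩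
  have h1' := ENNReal.toReal_mono (ENNReal.add_lt_top.mpr ⟨hfb, ENNReal.ofReal_lt_top⟩).ne h1
  have h2' := ENNReal.toReal_mono (ENNReal.add_lt_top.mpr ⟨hfa, ENNReal.ofReal_lt_top⟩).ne h2
  rw [ENNReal.toReal_add hfb.ne ENNReal.ofReal_ne_top, ENNReal.toReal_ofReal hc] at h1'
  rw [ENNReal.toReal_add hfa.ne ENNReal.ofReal_ne_top, ENNReal.toReal_ofReal hc] at h2'
  constructor <;> linarith

end Limsup

/-! ### From bounds on `E ‖x‖⁴` and `E ‖d‖²` to the exponent `3/2` -/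

section Comparison

/-- Mean squares of two network vectors `x` and `x - d`, compared through the fourth moment of `x`
and the second moment of `d`. -/
lemma meanSq_comparison {V Ω : Type*} [Fintype V] {M : ℕ} [MeasurableSpace Ω] {P : Measure Ω}
    [IsProbabilityMeasure P] {x d : Ω → V → Vec M} (hx : MemLp x 4 P) (hd : MemLp d 2 P)
    {μ K₄ K₅ : ℝ} (hμ : 0 < μ) (hμ1 : μ ≤ 1) (hK₄ : 0 ≤ K₄) (hK₅ : 0 ≤ K₅)
    (h4 : ∫ ω, ‖x ω‖ ^ 4 ∂P ≤ K₄ * μ ^ 2) (h2 : ∫ ω, ‖d ω‖ ^ 2 ∂P ≤ K₅ * μ ^ 2) :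
    ∫ ω, ∑ k, ‖x ω k‖ ^ 2 ∂P ≤ Fintype.card V * (K₄ + 1) * μ ∧
      ∫ ω, ∑ k, ‖d ω k‖ ^ 2 ∂P ≤ Fintype.card V * K₅ * μ ^ 2 ∧
      |∫ ω, ∑ k, ‖x ω k‖ ^ 2 ∂P - ∫ ω, ∑ k, ‖x ω k - d ω k‖ ^ 2 ∂P|
        ≤ (2 * (Fintype.card V * K₅) + Fintype.card V * (K₄ + 1)) * (μ * √μ) := by
  set n : ℝ := ((Fintype.card V : ℕ) : ℝ)
  have hn : 0 ≤ n := Nat.cast_nonneg _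
  have hx2 : MemLp x 2 P := hx.mono_exponent (by norm_num)
  have hsum : ∀ y : V → Vec M, ∑ k, ‖y k‖ ^ 2 ≤ n * ‖y‖ ^ 2 := by
    intro y
    have := Finset.sum_le_card_nsmul Finset.univ (fun k => ‖y k‖ ^ 2) (‖y‖ ^ 2) (fun k _ =>
      pow_le_pow_left₀ (norm_nonneg _) (norm_le_pi_norm y k) 2)
    simpa [n, Finset.card_univ] using this
  have hint : ∀ {y : Ω → V → Vec M}, MemLp y 2 P → Integrable (fun ω => ∑ k, ‖y ω k‖ ^ 2) P :=
    fun hy => integrable_finsetSum _ fun k _ =>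
      (memLp_pi_iff.mp hy k).integrable_norm_pow two_ne_zero
  -- The pointwise bound `s ≤ s² / μ + μ` with `s = ‖x‖²` replaces the Cauchy–Schwarz inequality.
  have hX : ∫ ω, ∑ k, ‖x ω k‖ ^ 2 ∂P ≤ n * (K₄ + 1) * μ := by
    have hi := (hx.integrable_pow_four.div_const μ)
    calc ∫ ω, ∑ k, ‖x ω k‖ ^ 2 ∂P ≤ ∫ ω, n * (‖x ω‖ ^ 4 / μ + μ) ∂P := by
          refine integral_mono (hint hx2) ((hi.add (integrable_const μ)).const_mul n) fun ω => ?_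
          refine (hsum (x ω)).trans (mul_le_mul_of_nonneg_left ?_ hn)
          have key : ‖x ω‖ ^ 4 / μ + μ - ‖x ω‖ ^ 2
              = ((‖x ω‖ ^ 2 - μ / 2) ^ 2 + 3 / 4 * μ ^ 2) / μ := by
            field_simp; ring
          have : 0 ≤ ((‖x ω‖ ^ 2 - μ / 2) ^ 2 + 3 / 4 * μ ^ 2) / μ := by positivity
          linarith
      _ = n * ((∫ ω, ‖x ω‖ ^ 4 ∂P) / μ + μ) := by
          rw [integral_const_mul, integral_add hi (integrable_const μ), integral_div]
          simp
      _ ≤ n * (K₄ * μ ^ 2 / μ + μ) := by gcongr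
      _ = _ := by field_simp
  have hD : ∫ ω, ∑ k, ‖d ω k‖ ^ 2 ∂P ≤ n * K₅ * μ ^ 2 := by
    calc ∫ ω, ∑ k, ‖d ω k‖ ^ 2 ∂P ≤ ∫ ω, n * ‖d ω‖ ^ 2 ∂P :=
          integral_mono (hint hd) ((hd.integrable_norm_pow two_ne_zero).const_mul n)
            fun ω => hsum (d ω)
      _ = n * ∫ ω, ‖d ω‖ ^ 2 ∂P := integral_const_mul _ _
      _ ≤ n * (K₅ * μ ^ 2) := mul_le_mul_of_nonneg_left h2 hn
      _ = _ := by ring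
  refine ⟨hX, hD, ?_⟩
  have hs : 0 < √μ := Real.sqrt_pos.mpr hμ
  have hss : √μ ^ 2 = μ := Real.sq_sqrt hμ.le
  have hs1 : √μ ≤ 1 := Real.sqrt_le_one.mpr hμ1
  -- Young's inequality with weight `√μ` balances `E ‖d‖² / √μ` against `√μ E ‖x‖²`; both are of
  -- order `μ √μ`.
  have hpt : ∀ ω, |∑ k, ‖x ω k‖ ^ 2 - ∑ k, ‖x ω k - d ω k‖ ^ 2|
      ≤ (1 + 1 / √μ) * ∑ k, ‖d ω k‖ ^ 2 + √μ * ∑ k, ‖x ω k‖ ^ 2 := by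
    intro ω
    rw [← Finset.sum_sub_distrib, Finset.mul_sum, Finset.mul_sum, ← Finset.sum_add_distrib]
    refine (Finset.abs_sum_le_sum_abs _ _).trans (Finset.sum_le_sum fun k _ => ?_)
    set a := x ω k
    set b := d ω k
    have h1 : ‖a‖ ^ 2 - ‖a - b‖ ^ 2 = 2 * inner ℝ a b - ‖b‖ ^ 2 := by
      rw [norm_sub_sq_real]; ring
    have h3 := abs_real_inner_le_norm a b
    have h4 : 2 * (‖a‖ * ‖b‖) ≤ √μ * ‖a‖ ^ 2 + 1 / √μ * ‖b‖ ^ 2 := by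
      have key : √μ * ‖a‖ ^ 2 + 1 / √μ * ‖b‖ ^ 2 - 2 * (‖a‖ * ‖b‖)
          = (√μ * ‖a‖ - ‖b‖) ^ 2 / √μ := by
        field_simp; ring
      have : 0 ≤ (√μ * ‖a‖ - ‖b‖) ^ 2 / √μ := by positivity
      linarith
    have h5 := sq_nonneg ‖b‖
    rw [h1]
    rw [abs_le] at h3 ⊢
    constructor <;> linarith [h3.1, h3.2]
  have hiX := hint hx2
  have hiD := hint hd
  have hiE : Integrable (fun ω => ∑ k, ‖x ω k - d ω k‖ ^ 2) P := hint (hx2.sub hd)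
  rw [← integral_sub hiX hiE]
  refine (abs_integral_le_integral_abs).trans ?_
  calc ∫ ω, |∑ k, ‖x ω k‖ ^ 2 - ∑ k, ‖x ω k - d ω k‖ ^ 2| ∂P
      ≤ ∫ ω, ((1 + 1 / √μ) * ∑ k, ‖d ω k‖ ^ 2 + √μ * ∑ k, ‖x ω k‖ ^ 2) ∂P :=
        integral_mono (hiX.sub hiE).abs ((hiD.const_mul _).add (hiX.const_mul _)) hpt
    _ = (1 + 1 / √μ) * ∫ ω, ∑ k, ‖d ω k‖ ^ 2 ∂P + √μ * ∫ ω, ∑ k, ‖x ω k‖ ^ 2 ∂P := by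
        rw [integral_add (hiD.const_mul _) (hiX.const_mul _), integral_const_mul,
          integral_const_mul]
    _ ≤ (1 + 1 / √μ) * (n * K₅ * μ ^ 2) + √μ * (n * (K₄ + 1) * μ) := by gcongr
    _ ≤ _ := by
        have e1 : μ ^ 2 ≤ μ * √μ := by
          have : μ ≤ √μ := by nlinarith
          nlinarith
        have e2 : 1 / √μ * μ ^ 2 = μ * √μ := by
          rw [div_mul_eq_mul_div, one_mul, div_eq_iff hs.ne', mul_assoc, ← sq √μ, hss, sq]
        have e3 : 0 ≤ n * K₅ := by positivity
        have e4 := mul_le_mul_of_nonneg_left e1 e3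
        have e5 : (1 + 1 / √μ) * (n * K₅ * μ ^ 2)
            = n * K₅ * μ ^ 2 + n * K₅ * (1 / √μ * μ ^ 2) := by ring
        rw [e5, e2]
        linarith

end Comparison

end WeakNet

end

/-! ### The main theorem -/

theorem mainTheorem4 {VS VR : Type*} [Fintype VS] [Fintype VR] [DecidableEq VR] {S R M : ℕ}
    (A : Matrix (VS ⊕ VR) (VS ⊕ VR) ℝ) (subS : VS → Fin S) (subR : VR → Fin R)
    (hA : WeakNet.IsWeaklyConnectedNetwork A subS subR)
    (J : VS ⊕ VR → WeakNet.Vec M → ℝ) (hJ : WeakNet.CostConditions subS J)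
    -- the step-sizes are `μ_k = τ_k μ_max` with `0 < τ_k ≤ 1`
    (τ : VS ⊕ VR → ℝ) (hτ : ∀ k, 0 < τ k ∧ τ k ≤ 1)
    (p : VS → ℝ) (hp : WeakNet.IsPerronFamily A subS p)
    -- the common factor `μ_max > 0` of the weights `q_k = μ_max τ_k p_k` plays no role here
    (wS : Fin S → WeakNet.Vec M)
    (hwS : WeakNet.IsParetoSolution subS J (fun k => τ (Sum.inl k) * p k) wS)
    (κ ε : ℝ) (hκ : 0 ≤ κ) (hε : 0 < ε)
    (hsmooth : WeakNet.HessianSmoothAt J (WeakNet.limitPoint A subS wS) κ ε)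
    (β σ : VS ⊕ VR → ℝ) :
    ∃ C μ₀ : ℝ, 0 < μ₀ ∧ ∀ μmax : ℝ, 0 < μmax → μmax ≤ μ₀ →
      ∀ (Ω : Type*) [MeasurableSpace Ω] (P : Measure Ω) [IsProbabilityMeasure P]
        (w g e' : VS ⊕ VR → ℕ → Ω → WeakNet.Vec M),
        WeakNet.IsDiffusion P A (fun k => τ k * μmax) w g →
        WeakNet.NoiseConditions P J w g β σ →
        (∀ k, MemLp (e' k 0) 2 P) →
        WeakNet.IsLongTermModel A J (WeakNet.limitPoint A subS wS) (fun k => τ k * μmax)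
          (WeakNet.gradNoise J w g) e' →
        WeakNet.IsNonlinearErrorModel A J (WeakNet.limitPoint A subS wS) (fun k => τ k * μmax)
            (WeakNet.gradNoise J w g) (WeakNet.errorVec (WeakNet.limitPoint A subS wS) w) ∧
        WeakNet.limsupMeanSq P
            (fun k i ω => WeakNet.errorVec (WeakNet.limitPoint A subS wS) w k i ω - e' k i ω)
          ≤ ENNReal.ofReal (C * μmax ^ 2) ∧
        WeakNet.limsupMeanSq P (WeakNet.errorVec (WeakNet.limitPoint A subS wS) w) < ⊤ ∧
        WeakNet.limsupMeanSq P e' < ⊤ ∧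
        |(WeakNet.limsupMeanSq P (WeakNet.errorVec (WeakNet.limitPoint A subS wS) w)).toReal
            - (WeakNet.limsupMeanSq P e').toReal| ≤ C * μmax ^ (3 / 2 : ℝ) := by
  classical
  set wstar := WeakNet.limitPoint A subS wS with hwstar
  have hfix : WeakNet.combineL A M wstar = wstar := hA.combineMap_limitMap hp wS
  obtain ⟨δ₀, hδ₀⟩ := hJ.hessian_bounded
  obtain ⟨δ, hδ0, hδ⟩ : ∃ δ : ℝ, 0 ≤ δ ∧ ∀ k x, ‖WeakNet.hessian (J k) x‖ ≤ δ :=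
    ⟨|δ₀|, abs_nonneg _, fun k x => (hδ₀ k x).trans (le_abs_self _)⟩
  obtain ⟨ν, hν0, hνs, hν⟩ := hJ.exists_modulus
  obtain ⟨N, T, K₁, hT, hL⟩ := hA.exists_lyapunov hp M
  have hLip := WeakNet.norm_costField_sub_le (wstar := wstar) hτ hJ.diff_gradient hδ0 hδ
  have hLipH := WeakNet.norm_hessField_sub_le (wstar := wstar) hτ hδ0 hδ
  have hτν0 : ∀ k : VS, 0 ≤ τ (Sum.inl k) * ν k := fun k => mul_nonneg (hτ _).1.le (hν0 k)
  have hτν : ∀ s, ∃ k, subS k = s ∧ 0 < τ (Sum.inl k) * ν k := fun s => by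
    obtain ⟨k, hk, hpos⟩ := hν s
    exact ⟨k, hk, mul_pos (hτ _).1 hpos⟩
  obtain ⟨a, b₀, μa, ha, hb₀, hμa, hdrift⟩ := hL (WeakNet.costField J wstar τ) δ
    (fun k => τ (Sum.inl k) * ν k) hδ0 hLip (by
      -- The Pareto condition says exactly that the bias `costField 0` has vanishing centroids.
      ext1 s
      have h1 := hwS s
      rw [WeakNet.centroid_apply, Pi.zero_apply, ← neg_eq_zero, ← Finset.sum_neg_distrib, ← h1]
      refine Finset.sum_congr rfl fun k hk => ?_
      rw [← (Finset.mem_filter.mp hk).2]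
      simp only [WeakNet.costField, Pi.zero_apply, sub_zero, hwstar, WeakNet.limitPoint]
      module) hτν0 hτν
    (fun k x => WeakNet.le_inner_costField (hτ _).1 (hνs k) (hJ.diff _) x)
  obtain ⟨aH, bH, μH, haH, hbH, hμH, hdriftH⟩ := hL (WeakNet.hessField J wstar τ) δ
    (fun k => τ (Sum.inl k) * ν k) hδ0 hLipH (by rw [WeakNet.hessField_zero, map_zero]) hτν0 hτν
    (fun k x => WeakNet.le_inner_hessField (hτ _).1 (hνs k) (hJ.diff _) (hJ.diff_gradient _) x)
  set f₀ := WeakNet.costField J wstar τ 0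
  obtain ⟨K₄, μb, hK₄, hμb, hfourth⟩ := WeakNet.exists_fourth_moment_bound (WeakNet.combineL A M) T
    (a := a) (b := b₀ * ‖f₀‖ ^ 2) (K₂ := ∑ k, (8 * β k ^ 4 + 8 * β k ^ 4 * ‖wstar k‖ ^ 4 + σ k ^ 4))
    ha (by positivity) hT (Finset.sum_nonneg fun k _ => by positivity)
  obtain ⟨K₅, μc, hK₅, hμc, hsecond⟩ := WeakNet.exists_second_moment_bound (WeakNet.combineL A M) T
    (a := aH) (K₂ := K₄) (K₃ := κ + 2 * δ / ε) haH hT hK₄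
  set n : ℝ := ((Fintype.card (VS ⊕ VR) : ℕ) : ℝ)
  have hn : 0 ≤ n := Nat.cast_nonneg _
  -- The constant of `meanSq_comparison`, which also dominates the factor `n * K₅` in the bound on
  -- the difference.
  refine ⟨2 * (n * K₅) + n * (K₄ + 1), min 1 (min (min μa μH) (min μb μc)),
    lt_min one_pos (lt_min (lt_min hμa hμH) (lt_min hμb hμc)), ?_⟩
  intro μ hμ hμ0 Ω _ P _ w g e' hdiff hnoise he0 hlong
  have hμ1 : μ ≤ 1 := hμ0.trans (min_le_left _ _)
  have hμ2 := hμ0.trans (min_le_right _ _)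
  have hμ3 := hμ2.trans (min_le_left _ _)
  have hμ4 := hμ2.trans (min_le_right _ _)
  set x : ℕ → Ω → (VS ⊕ VR → WeakNet.Vec M) :=
    fun i ω k => WeakNet.errorVec wstar w k i ω with hxdef
  set d : ℕ → Ω → (VS ⊕ VR → WeakNet.Vec M) := fun i ω => x i ω - fun k => e' k i ω with hddef
  have hxrec : ∀ i ω, x (i + 1) ω = WeakNet.combineL A M
      (x i ω - μ • WeakNet.costField J wstar τ (x i ω))
        + μ • WeakNet.combineL A M (WeakNet.scaledNoise J τ w g i ω) :=
    WeakNet.errorVec_succ hdiff.combine hfix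
  have herec := hlong.succ_eq
  have hz : ∀ i, MemLp (WeakNet.scaledNoise J τ w g i) 4 P := hnoise.memLp_scaledNoise
  have hx4 : ∀ i, MemLp (x i) 4 P := by
    intro i
    induction i with
    | zero => exact memLp_pi_iff.mpr fun k => (memLp_const (wstar k)).sub (hdiff.initial k)
    | succ i ih =>
      rw [funext (hxrec i)]
      exact ((WeakNet.combineL A M).comp_memLp' (ih.sub
        ((WeakNet.memLp_comp_of_norm_sub_le hδ0 hLip ih).const_smul μ))).add
        (((WeakNet.combineL A M).comp_memLp' (hz i)).const_smul μ)
  have he2 : ∀ i, MemLp (fun ω => (fun k => e' k i ω : VS ⊕ VR → WeakNet.Vec M)) 2 P := by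
    intro i
    induction i with
    | zero => exact memLp_pi_iff.mpr he0
    | succ i ih =>
      rw [funext (herec i)]
      exact ((WeakNet.combineL A M).comp_memLp' ((ih.sub
        ((WeakNet.memLp_comp_of_norm_sub_le hδ0 hLipH ih).const_smul μ)).sub
          (memLp_const (μ • f₀)))).add
        (((WeakNet.combineL A M).comp_memLp' ((hz i).mono_exponent (by norm_num))).const_smul μ)
  have hx2 : ∀ i, MemLp (x i) 2 P := fun i => (hx4 i).mono_exponent (by norm_num)
  have hd2 : ∀ i, MemLp (d i) 2 P := fun i => (hx2 i).sub (he2 i)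
  -- Both models have the same noise and the same bias `f₀`, so only the linearization remainder at
  -- `x i ω` drives the difference.
  have hdrec : ∀ i ω, d (i + 1) ω = WeakNet.combineL A M
      (d i ω - μ • WeakNet.hessField J wstar τ (d i ω))
        + μ • WeakNet.combineL A M (WeakNet.hessField J wstar τ (x i ω)
          - (WeakNet.costField J wstar τ (x i ω) - f₀)) := by
    intro i ω
    simp only [hddef]
    rw [hxrec, herec, WeakNet.hessField_sub, ← map_smul, ← map_smul, ← map_add, ← map_add,
      ← map_sub, ← map_add]
    congr 1
    module
  have hev4 : ∀ᶠ i in Filter.atTop, ∫ ω, ‖x i ω‖ ^ 4 ∂P ≤ K₄ * μ ^ 2 := by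
    refine hfourth μ hμ (hμ4.trans (min_le_left _ _))
      (fun y => WeakNet.combineL A M (y - μ • WeakNet.costField J wstar τ y))
      ((WeakNet.combineL A M).continuous.comp (continuous_id.sub
        ((WeakNet.continuous_of_norm_sub_le hδ0 hLip).const_smul μ)))
      (hdrift μ hμ (hμ3.trans (min_le_left _ _))) P (WeakNet.pastSigma w) x
      (WeakNet.scaledNoise J τ w g) (WeakNet.pastSigma_le hdiff.measurable) hx4 hz
      WeakNet.stronglyMeasurable_errorVec (fun i => ?_)
      (fun i => hnoise.integral_scaledNoise_le hτ hdiff.measurable i (hx4 i)) hxrec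
    have h1 := (T.comp (WeakNet.combineL A M)).comp_condExp_comm (m := WeakNet.pastSigma w i)
      ((hz i).integrable (by norm_num))
    filter_upwards [h1, hnoise.condExp_scaledNoise (τ := τ) i] with ω e1 e2
    refine e1.symm.trans ?_
    rw [Function.comp_apply, e2, Pi.zero_apply, map_zero, Pi.zero_apply]
  have hev2 : ∀ᶠ i in Filter.atTop, ∫ ω, ‖d i ω‖ ^ 2 ∂P ≤ K₅ * μ ^ 2 := by
    refine hsecond μ hμ (hμ4.trans (min_le_right _ _))
      (fun y => WeakNet.combineL A M (y - μ • WeakNet.hessField J wstar τ y)) (fun y => ?_) P x d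
      _ hx4 hd2 (fun i ω => WeakNet.norm_hessField_sub_costField_le hτ hJ.diff_gradient hδ0 hδ hκ
        hε hsmooth (x i ω)) hdrec hev4
    have := hdriftH μ hμ (hμ3.trans (min_le_right _ _)) y
    -- The linear field vanishes at zero, so its drift has no offset.
    rw [WeakNet.hessField_zero, norm_zero] at this
    simpa using this
  have hcomp : ∀ᶠ i in Filter.atTop, _ := (hev4.and hev2).mono fun i hi =>
    WeakNet.meanSq_comparison (hx4 i) (hd2 i) hμ hμ1 hK₄ hK₅ hi.1 hi.2
  have hμs : μ ^ (3 / 2 : ℝ) = μ * √μ := by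
    rw [show (3 / 2 : ℝ) = 1 + 1 / 2 by norm_num, Real.rpow_add hμ, Real.rpow_one,
      Real.sqrt_eq_rpow]
  have hxk : ∀ k i, MemLp (WeakNet.errorVec wstar w k i) 2 P := fun k i =>
    memLp_pi_iff.mp (hx2 i) k
  have hek : ∀ k i, MemLp (e' k i) 2 P := fun k i => memLp_pi_iff.mp (he2 i) k
  have hdk : ∀ k i, MemLp (fun ω => WeakNet.errorVec wstar w k i ω - e' k i ω) 2 P := fun k i =>
    (hxk k i).sub (hek k i)
  have hlim := WeakNet.toReal_limsup_sub_le
    (a := fun i => ∫ ω, ∑ k, ‖WeakNet.errorVec wstar w k i ω‖ ^ 2 ∂P)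
    (b := fun i => ∫ ω, ∑ k, ‖e' k i ω‖ ^ 2 ∂P)
    (c := (2 * (n * K₅) + n * (K₄ + 1)) * (μ * √μ)) (by positivity)
    (hcomp.mono fun i hi => hi.1)
    (hcomp.mono fun i hi => by
      have := hi.2.2
      simp only [hddef, hxdef, Pi.sub_apply, sub_sub_cancel] at this
      exact this)
  refine ⟨WeakNet.isNonlinearErrorModel hdiff.combine hfix hJ.diff_gradient hδ, ?_, ?_⟩
  · rw [WeakNet.limsupMeanSq_eq hdk]
    refine Filter.limsup_le_of_le (h := hcomp.mono fun i hi => ENNReal.ofReal_le_ofReal ?_)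
    refine hi.2.1.trans (mul_le_mul_of_nonneg_right ?_ (sq_nonneg μ))
    have h1 : 0 ≤ n * K₅ := by positivity
    have h2 : 0 ≤ n * (K₄ + 1) := by positivity
    linarith
  · rw [WeakNet.limsupMeanSq_eq hxk, WeakNet.limsupMeanSq_eq hek, hμs]
    exact hlim
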